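/- Let $X$ be an $n$-element set and write $\mathcal{P}X$ for the set of all subsets of $X$. An *equipartition* of $X$ into $k$ classes is a partition $(S_i)_{i=1}^{k}$ of $X$ whose class sizes are as equal as possible. For an equipartition $(V_i)_{i=1}^{k}$ of $X$ put \[\mathcal{F}_{n,k} = \bigcup_{i=1}^{k} \mathcal{P}(V_i) \setminus \{\emptyset\};\] its size depends only on $n$ and $k$, and equals $k2^{n/k}-k$ when $k$ divides $n$. A family $\mathcal{G} \subset \mathcal{P}X$ is said to *$k$-generate* a family $\mathcal{A} \subset \mathcal{P}X$ if every set in $\mathcal{A}$ is a union of at most $k$ pairwise disjoint sets in $\mathcal{G}$. **Proposition.** For every integer $k \geq 1$ there exist constants $C_k, D_k, \xi_k > 0$, depending only on $k$, such that the following holds. Let $n$ be a multiple of $k$, let $X$ be an $n$-element set, let $\epsilon, \eta \geq 0$ be real numbers, and let $\mathcal{G} \subset \mathcal{P}X$ be a family which satisfies $|\mathcal{G}| \leq (1+\eta)|\mathcal{F}_{n,k}|$ and which $k$-generates at least $(1-\epsilon)2^{n}$ subsets of $X$. Then there exists an equipartition $(S_i)_{i=1}^{k}$ of $X$ such that \[\Big|\mathcal{G}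 \cap \bigcup_{i=1}^{k} \mathcal{P}(S_i)\Big| \geq \left(1 - C_k \epsilon^{1/k} - D_k \eta^{1/k} - 2^{-\xi_k n}\right)|\mathcal{F}_{n,k}|.\] -/

import Mathlib

namespace DisjointGen

/-- A family `S 0, …, S (k-1)` of subsets of `X` is an equipartition of `X` into `k` classes: the
classes are pairwise disjoint, cover `X`, and their sizes are as equal as possible, that is, any
two of them differ by at most one. (Classes may be empty, which happens only if `|X| < k`.) -/
def IsEquipartition {X : Type*} [Fintype X] [DecidableEq X] {k : ℕ} (S : Fin k → Finset X) :
    Prop :=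
  Pairwise (fun i j => Disjoint (S i) (S j)) ∧
    Finset.univ.biUnion S = Finset.univ ∧
    Set.EquitableOn Set.univ (fun i => (S i).card)

/-- The family of all subsets of `X` that lie inside one of the classes. -/
def classSubsets {X : Type*} [DecidableEq X] {k : ℕ} (S : Fin k → Finset X) :
    Finset (Finset X) :=
  Finset.univ.biUnion (fun i => (S i).powerset)

/-- The union of the power-sets of the classes, without the empty set. If `V` is an equipartition
of an `n`-element set into `k` classes, this is the canonical `k`-generator `F_{n,k}`. -/
def canonicalGenerator {X : Type*} [DecidableEq X] {k : ℕ} (V : Fin k → Finset X) :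
    Finset (Finset X) :=
  classSubsets V \ {∅}

/-- `x` is a union of at most `k` (distinct) pairwise disjoint members of `G`. -/
def IsDisjointUnion {X : Type*} [DecidableEq X] (k : ℕ) (G : Finset (Finset X)) (x : Finset X) :
    Prop :=
  ∃ P : Finset (Finset X), P ⊆ G ∧ P.card ≤ k ∧
    (P : Set (Finset X)).PairwiseDisjoint id ∧ P.biUnion id = x

/-- `G` `k`-generates the family `F`: every member of `F` is a disjoint union of at most `k`
members of `G`. -/
def KGenerates {X : Type*} [DecidableEq X] (k : ℕ) (G F : Finset (Finset X)) : Prop :=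
  ∀ x ∈ F, IsDisjointUnion k G x

/-- In the case `k ∣ n`, the size of a canonical `k`-generator does not depend on the chosen
equipartition: it is `k (2 ^ (n / k) - 1)`. -/
theorem card_canonicalGenerator {X : Type*} [Fintype X] [DecidableEq X] {k : ℕ}
    (hk : k ∣ Fintype.card X) {V : Fin k → Finset X} (hV : IsEquipartition V) :
    (canonicalGenerator V).card = k * (2 ^ (Fintype.card X / k) - 1) := by
  obtain ⟨hd, hu, hb⟩ := hV
  have hsum : ∑ i, (V i).card = Fintype.card X := by
    rw [← Finset.card_biUnion (fun i _ j _ hij => hd hij), hu, Finset.card_univ]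
  have hcard : ∀ i, (V i).card = Fintype.card X / k := by
    obtain ⟨q, hq⟩ := hk
    intro i
    have hk0 : 0 < k := i.pos
    rw [hq, Nat.mul_div_cancel_left _ hk0]
    have hb' : ∀ j l, (V j).card ≤ (V l).card + 1 :=
      fun j l => hb (Set.mem_univ j) (Set.mem_univ l)
    by_contra hne
    rcases lt_or_gt_of_ne hne with h | h
    · have : ∑ j, (V j).card < ∑ _j : Fin k, q :=
        Finset.sum_lt_sum (fun j _ => by have := hb' j i; have := hb' i j; omega)
          ⟨i, Finset.mem_univ i, h⟩
      simp at this
      omega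
    · have : ∑ _j : Fin k, q < ∑ j, (V j).card :=
        Finset.sum_lt_sum (fun j _ => by have := hb' j i; have := hb' i j; omega)
          ⟨i, Finset.mem_univ i, h⟩
      simp at this
      omega
  have heq : canonicalGenerator V = Finset.univ.biUnion (fun i => (V i).powerset \ {∅}) := by
    ext x
    simp [canonicalGenerator, classSubsets]
  rw [heq, Finset.card_biUnion]
  · simp [Finset.card_sdiff, hcard]
  · intro i _ j _ hij
    rw [Function.onFun, Finset.disjoint_left]
    intro x hx hx'
    simp only [Finset.mem_sdiff, Finset.mem_powerset, Finset.mem_singleton] at hx hx'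
    exact hx.2 (Finset.subset_empty.mp ((hd hij) hx.1 hx'.1))

end DisjointGen

/-!
Write `n = k * q` and let `V` be the set of nonempty members of `G`, with `m = #V`, so that `m` is
at most about `k * 2 ^ q`. Families of fewer than `k` members of `V` produce only a proportion
`O(2 ^ (-q))` of all subsets of `X`; hence `V` contains almost `2 ^ n` families of `k` pairwise
disjoint sets, that is, `k`-cliques of the disjointness relation, which is nearly as many as the
balanced complete `k`-partite relation on `m` points has.

On the other hand `V` has exponentially few `(k + 1)`-cliques (`exists_card_cliques_le`). A random
tuple of boundedly many members of `V` almost surely has a union of more than `n / (k + 1)`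
elements, and `k + 1` disjoint unions of that size do not fit into `X`; a power mean inequality
turns this into a bound for single cliques.

With few `(k + 1)`-cliques, the Moon–Moser inequalities (`moon_moser`) bound the number of
`(k - 1)`-cliques from above by about its value in the complete `k`-partite relation. Averaging over
all `k`-cliques `c` (`exists_clique_partition`) then gives one for which the sets `B i` of points
related to all entries of `c` but the `i`-th cover almost all of `V` and contain few related pairs.
So almost every subset of `X` is a disjoint union of a transversal of the `B i`
(`card_sub_card_transversals_mul_le`), while the product of the sizes of the `B i` is hardly larger
than `2 ^ n`.

Since about half of all subsets contain a given element `x`, some `B i` has a constant proportion of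
members containing `x` (`exists_heavy`). Let `S i` consist of the elements assigned to `i` in this
way. A member of `B i` that meets `S j` for some `j ≠ i` intersects a constant proportion of `B j`,
and as almost all tuples are disjoint, there are few such members: almost all of `B i` lies in the
power set of `S i`. By the equality case of the inequality of arithmetic and geometric means each
`B i` has nearly `2 ^ q` members, more than `2 ^ (q - 1)` of them inside `S i`; so `S i` has at least
`q` elements, hence exactly `q`.

All error terms are linear in `ε`, in `η` and in an exponentially small quantity, which is stronger
than the exponent `1 / k` of the statement when `ε` and `η` are small. For bounded `n` the constants
are chosen such that the claim only asks for one member of `G` in some class, and singletons serve.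
-/

namespace DisjointGen
open Finset

/-! ### Counting points of a product of finite sets -/

section Pi
variable {ι α : Type*} [Fintype ι] [DecidableEq ι] [DecidableEq α]

theorem card_piFinset_filter_mem_mul (B : ι → Finset α) (i : ι) (D : Finset α) (hD : D ⊆ B i) :
    #{a ∈ Fintype.piFinset B | a i ∈ D} * #(B i) = #D * ∏ l, #(B l) := by
  have h : {a ∈ Fintype.piFinset B | a i ∈ D} = Fintype.piFinset (Function.update B i D) := by
    ext a
    simp only [mem_filter, Fintype.mem_piFinset]
    constructor
    · rintro ⟨h1, h2⟩ j
      by_cases hj : j = i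
      · subst hj; simpa using h2
      · simpa [hj] using h1 j
    · intro h
      refine ⟨fun j => ?_, by simpa using h i⟩
      by_cases hj : j = i
      · subst hj; exact hD (by simpa using h j)
      · simpa [hj] using h j
  rw [h, Fintype.card_piFinset, ← mul_prod_erase univ _ (mem_univ i),
    ← mul_prod_erase univ (fun l => #(B l)) (mem_univ i)]
  have : ∏ x ∈ univ.erase i, #(Function.update B i D x) = ∏ x ∈ univ.erase i, #(B x) :=
    prod_congr rfl fun x hx => by rw [Function.update_of_ne (ne_of_mem_erase hx)]
  rw [this, Function.update_self]
  ring

/-- The tuples of a product whose `i`-th and `j`-th coordinates are prescribed to form a pair in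
`E` have the same density in the product as `E` has in the product of these two factors. -/
theorem card_piFinset_filter_pair_mul (B : ι → Finset α) {i j : ι} (hij : i ≠ j)
    (E : Finset (α × α)) (hE : E ⊆ B i ×ˢ B j) :
    #{a ∈ Fintype.piFinset B | (a i, a j) ∈ E} * (#(B i) * #(B j)) = #E * ∏ l, #(B l) := by
  rw [← card_product, ← Fintype.card_piFinset, ← card_product, ← card_product]
  -- exchange the two coordinates of the tuple with the extra pair
  refine card_bij'
    (fun p _ => ((p.1 i, p.1 j), Function.update (Function.update p.1 i p.2.1) j p.2.2))
    (fun q _ => (Function.update (Function.update q.2 i q.1.1) j q.1.2, (q.2 i, q.2 j)))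
    ?_ ?_ ?_ ?_
  · rintro ⟨a, u, v⟩ h
    simp only [mem_product, mem_filter, Fintype.mem_piFinset] at h ⊢
    refine ⟨h.1.2, fun l => ?_⟩
    by_cases hl : l = j
    · subst hl; simpa using h.2.2
    · by_cases hl' : l = i
      · subst hl'; simpa [hl] using h.2.1
      · simpa [hl, hl'] using h.1.1 l
  · rintro ⟨⟨u, v⟩, a⟩ h
    simp only [mem_product, mem_filter, Fintype.mem_piFinset] at h ⊢
    have huv := mem_product.1 (hE h.1)
    refine ⟨⟨fun l => ?_, by simpa [hij] using h.1⟩, h.2 i, h.2 j⟩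
    by_cases hl : l = j
    · subst hl; simpa using huv.2
    · by_cases hl' : l = i
      · subst hl'; simpa [hl] using huv.1
      · simpa [hl, hl'] using h.2 l
  · rintro ⟨a, u, v⟩ h
    ext l
    · by_cases hl : l = j
      · subst hl; simp
      · by_cases hl' : l = i
        · subst hl'; simp [hl]
        · simp [hl, hl']
    · simp [hij]
    · simp
  · rintro ⟨⟨u, v⟩, a⟩ h
    ext l
    · simp [hij]
    · simp
    · by_cases hl : l = j
      · subst hl; simp
      · by_cases hl' : l = i
        · subst hl'; simp [hl]
        · simp [hl, hl']

end Pi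

/-! ### Ordered cliques -/

section Cliques
variable {α : Type*} (R : α → α → Prop) [DecidableRel R] (V : Finset α)

/-- The ordered `r`-cliques of the relation `R` on `V`: the `r`-tuples of members of `V` any two
entries of which are related. -/
def cliques (r : ℕ) : Finset (Fin r → α) :=
  {c ∈ Fintype.piFinset fun _ : Fin r => V | ∀ i j, i ≠ j → R (c i) (c j)}

/-- The members of `V` related to every entry of the tuple `e`. -/
def commonNbrs {r : ℕ} (e : Fin r → α) : Finset α := {v ∈ V | ∀ j, R v (e j)}

/-- The members of `V` related to every entry of the tuple `c` except the `i`-th one. -/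
def soleNonNbrs {r : ℕ} (c : Fin r → α) (i : Fin r) : Finset α :=
  {v ∈ V | ∀ j, R v (c j) ↔ j ≠ i}

/-- The ordered pairs of related members of `A`. -/
def relPairs (A : Finset α) : Finset (α × α) := {p ∈ A ×ˢ A | R p.1 p.2}

variable {R V}

theorem mem_cliques {r : ℕ} {c : Fin r → α} :
    c ∈ cliques R V r ↔ (∀ i, c i ∈ V) ∧ ∀ i j, i ≠ j → R (c i) (c j) := by
  simp [cliques]

theorem mem_commonNbrs {r : ℕ} {e : Fin r → α} {v : α} :
    v ∈ commonNbrs R V e ↔ v ∈ V ∧ ∀ j, R v (e j) := by simp [commonNbrs]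

theorem mem_soleNonNbrs {r : ℕ} {c : Fin r → α} {i : Fin r} {v : α} :
    v ∈ soleNonNbrs R V c i ↔ v ∈ V ∧ ∀ j, R v (c j) ↔ j ≠ i := by simp [soleNonNbrs]

theorem card_cliques_zero : #(cliques R V 0) = 1 := by
  have : cliques R V 0 = univ := by
    ext c; simpa [mem_cliques] using Subsingleton.elim _ _
  rw [this]; simp

theorem card_cliques_le (r : ℕ) : #(cliques R V r) ≤ #V ^ r := by
  refine (card_filter_le _ _).trans ?_
  simp

theorem insertNth_mem_cliques (hR : ∀ a b, R a b → R b a) {r : ℕ} (i : Fin (r + 1)) {v : α}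
    {e : Fin r → α} :
    i.insertNth (α := fun _ => α) v e ∈ cliques R V (r + 1) ↔
      e ∈ cliques R V r ∧ v ∈ commonNbrs R V e := by
  simp only [mem_cliques, mem_commonNbrs]
  constructor
  · rintro ⟨h1, h2⟩
    refine ⟨⟨fun j => ?_, fun j l hjl => ?_⟩, ?_, fun j => ?_⟩
    · simpa using h1 (i.succAbove j)
    · simpa using h2 (i.succAbove j) (i.succAbove l) (by simpa using hjl)
    · simpa using h1 i
    · simpa using h2 i (i.succAbove j) (Fin.succAbove_ne i j).symm
  · rintro ⟨⟨h1, h2⟩, h3, h4⟩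
    constructor
    · rw [Fin.forall_iff_succAbove i]
      simpa using ⟨h3, h1⟩
    · rw [Fin.forall_iff_succAbove i]
      constructor
      · rw [Fin.forall_iff_succAbove i]
        simpa using h4
      · intro j
        rw [Fin.forall_iff_succAbove i]
        refine ⟨fun _ => ?_, fun l hl => ?_⟩
        · simpa using hR _ _ (h4 j)
        · simpa using h2 j l (by simpa using hl)

theorem sum_cliques_succ (hR : ∀ a b, R a b → R b a) {M : Type*} [AddCommMonoid M] {r : ℕ}
    (i : Fin (r + 1)) (g : (Fin (r + 1) → α) → M) :
    ∑ c ∈ cliques R V (r + 1), g c =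
      ∑ e ∈ cliques R V r, ∑ v ∈ commonNbrs R V e, g (i.insertNth (α := fun _ => α) v e) := by
  rw [sum_sigma']
  refine sum_bij' (fun c _ => ⟨i.removeNth c, c i⟩) (fun p _ => i.insertNth p.2 p.1) ?_ ?_ ?_ ?_ ?_
  · intro c hc
    rw [← Fin.insertNth_self_removeNth i c, insertNth_mem_cliques hR] at hc
    simpa using hc
  · rintro ⟨e, v⟩ h
    rw [insertNth_mem_cliques hR]
    simpa using h
  · intro c _; simp
  · rintro ⟨e, v⟩ _; simp
  · intro c _; simp

theorem card_cliques_succ (hR : ∀ a b, R a b → R b a) (r : ℕ) :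
    #(cliques R V (r + 1)) = ∑ e ∈ cliques R V r, #(commonNbrs R V e) := by
  rw [card_eq_sum_ones, sum_cliques_succ hR 0]
  simp

theorem sum_card_commonNbrs_removeNth (hR : ∀ a b, R a b → R b a) {r : ℕ} (i : Fin (r + 1)) :
    ∑ c ∈ cliques R V (r + 1), #(commonNbrs R V (i.removeNth c)) =
      ∑ e ∈ cliques R V r, #(commonNbrs R V e) ^ 2 := by
  rw [sum_cliques_succ hR i]
  simp [sq]

theorem card_cliques_succ_sq_le (hR : ∀ a b, R a b → R b a) (r : ℕ) :
    #(cliques R V (r + 1)) ^ 2 ≤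
      #(cliques R V r) * ∑ e ∈ cliques R V r, #(commonNbrs R V e) ^ 2 := by
  rw [card_cliques_succ hR]
  exact sq_sum_le_card_mul_sum_sq

/-- A common neighbour of all entries of `c` but the `i`-th is either related to the `i`-th as well or
not. -/
theorem card_commonNbrs_removeNth {r : ℕ} (c : Fin (r + 1) → α) (i : Fin (r + 1)) :
    #(commonNbrs R V (i.removeNth c)) = #(soleNonNbrs R V c i) + #(commonNbrs R V c) := by
  classical
  rw [← card_union_of_disjoint]
  · congr 1
    ext v
    simp only [mem_union, mem_commonNbrs, mem_soleNonNbrs, ← and_or_left]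
    refine and_congr_right fun _ => ?_
    rw [Fin.forall_iff_succAbove (P := fun j => R v (c j) ↔ j ≠ i) i,
      Fin.forall_iff_succAbove (P := fun j => R v (c j)) i]
    simp only [Fin.removeNth, ne_eq, not_true, iff_false, Fin.succAbove_ne, not_false_eq_true,
      iff_true]
    tauto
  · rw [disjoint_left]
    intro v hv hv'
    exact absurd rfl (((mem_soleNonNbrs.1 hv).2 i).1 ((mem_commonNbrs.1 hv').2 i))

theorem disjoint_soleNonNbrs {r : ℕ} (c : Fin r → α) {i j : Fin r} (hij : i ≠ j) :
    Disjoint (soleNonNbrs R V c i) (soleNonNbrs R V c j) := by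
  rw [disjoint_left]
  intro v hv hv'
  exact absurd rfl (((mem_soleNonNbrs.1 hv').2 j).1 (((mem_soleNonNbrs.1 hv).2 j).2 hij.symm))

theorem card_biUnion_soleNonNbrs [DecidableEq α] {r : ℕ} (c : Fin r → α) :
    #(univ.biUnion (soleNonNbrs R V c)) = ∑ i, #(soleNonNbrs R V c i) :=
  card_biUnion fun _ _ _ _ hij => disjoint_soleNonNbrs c hij

theorem sum_soleNonNbrs_add_le {r : ℕ} (c : Fin (r + 1) → α) :
    ∑ i, #(soleNonNbrs R V c i) + #(commonNbrs R V c) ≤ #V := by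
  classical
  rw [← card_biUnion_soleNonNbrs, ← card_union_of_disjoint]
  · refine card_le_card (union_subset (biUnion_subset.2 fun i _ => filter_subset _ _)
      (filter_subset _ _))
  · rw [disjoint_left]
    intro v hv hv'
    obtain ⟨i, -, hv⟩ := mem_biUnion.1 hv
    exact absurd rfl (((mem_soleNonNbrs.1 hv).2 i).1 ((mem_commonNbrs.1 hv').2 i))

theorem sum_sum_soleNonNbrs (hR : ∀ a b, R a b → R b a) (r : ℕ) :
    ∑ c ∈ cliques R V (r + 1), ∑ i, #(soleNonNbrs R V c i) + (r + 1) * #(cliques R V (r + 2)) =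
      (r + 1) * ∑ e ∈ cliques R V r, #(commonNbrs R V e) ^ 2 := by
  have h : ∑ i : Fin (r + 1), ∑ c ∈ cliques R V (r + 1), #(commonNbrs R V (i.removeNth c)) =
      (r + 1) * ∑ e ∈ cliques R V r, #(commonNbrs R V e) ^ 2 := by
    simp [sum_card_commonNbrs_removeNth hR]
  rw [← h, card_cliques_succ hR (r + 1), mul_sum, ← sum_add_distrib]
  simp only [card_commonNbrs_removeNth]
  rw [sum_comm (s := univ)]
  refine sum_congr rfl fun c _ => ?_
  simp [sum_add_distrib]

/-- The **Moon–Moser inequality** for ordered cliques. -/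
theorem moon_moser (hR : ∀ a b, R a b → R b a) (r : ℕ) :
    (r + 1) * #(cliques R V (r + 1)) ^ 2 ≤
      #(cliques R V r) * (#V * #(cliques R V (r + 1)) + r * #(cliques R V (r + 2))) := by
  have h1 := card_cliques_succ_sq_le (V := V) hR r
  have h2 := sum_sum_soleNonNbrs (V := V) hR r
  have h3 : ∑ c ∈ cliques R V (r + 1), ∑ i, #(soleNonNbrs R V c i) + #(cliques R V (r + 2)) ≤
      #V * #(cliques R V (r + 1)) := by
    rw [card_cliques_succ hR (r + 1), ← sum_add_distrib]
    refine (sum_le_sum fun c _ => sum_soleNonNbrs_add_le c).trans ?_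
    simp [mul_comm]
  calc (r + 1) * #(cliques R V (r + 1)) ^ 2
      ≤ #(cliques R V r) * ((r + 1) * ∑ e ∈ cliques R V r, #(commonNbrs R V e) ^ 2) := by
        nlinarith [h1]
    _ ≤ _ := by
        gcongr
        rw [← h2]
        linarith

/-- A related pair inside the common neighbourhood of an `r`-clique extends that clique to an
`(r + 2)`-clique. -/
theorem sum_relPairs_commonNbrs_le (hR : ∀ a b, R a b → R b a) {r : ℕ} (i : Fin (r + 1)) :
    ∑ c ∈ cliques R V (r + 1), #(relPairs R (commonNbrs R V (i.removeNth c))) ≤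
      #V * #(cliques R V (r + 2)) := by
  have h0 : ∀ e ∈ cliques R V r, #(relPairs R (commonNbrs R V e)) =
      ∑ v ∈ commonNbrs R V e, #(commonNbrs R V (i.insertNth (α := fun _ => α) v e)) := by
    intro e _
    rw [← card_sigma]
    refine card_bij' (fun p _ => ⟨p.1, p.2⟩) (fun p _ => (p.1, p.2)) ?_ ?_ ?_ ?_
    · rintro ⟨u, v⟩ h
      simp only [relPairs, mem_filter, mem_product, mem_commonNbrs] at h
      simp only [mem_sigma, mem_commonNbrs, Fin.forall_iff_succAbove i]
      simpa using ⟨h.1.1, h.1.2.1, hR _ _ h.2, h.1.2.2⟩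
    · rintro ⟨u, v⟩ h
      simp only [mem_sigma, mem_commonNbrs, Fin.forall_iff_succAbove i] at h
      simp only [relPairs, mem_filter, mem_product, mem_commonNbrs]
      simp only [Fin.insertNth_apply_same, Fin.insertNth_apply_succAbove] at h
      exact ⟨⟨h.1, h.2.1, h.2.2.2⟩, hR _ _ h.2.2.1⟩
    · rintro ⟨u, v⟩ _; rfl
    · rintro ⟨u, v⟩ _; rfl
  rw [sum_cliques_succ hR i, card_cliques_succ hR (r + 1), sum_cliques_succ hR i, mul_sum]
  refine sum_le_sum fun e he => ?_
  simp only [Fin.removeNth_insertNth, sum_const, smul_eq_mul]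
  rw [h0 e he]
  exact Nat.mul_le_mul_right _ (card_filter_le _ _)

/-- Averaging over all `(r + 1)`-cliques `c`: for a suitable `c`, few members of `V` lie outside
the sets `soleNonNbrs R V c i`, and there are few related pairs inside any of them, provided that
`V` has many `(r + 1)`-cliques compared to `r`-cliques and few `(r + 2)`-cliques. -/
theorem exists_clique_partition (hR : ∀ a b, R a b → R b a) (r : ℕ)
    (hpos : 0 < #(cliques R V (r + 1))) :
    ∃ c ∈ cliques R V (r + 1),
      ((#V : ℝ) - ∑ i, (#(soleNonNbrs R V c i) : ℝ)) * #V
          + ∑ i, (#(relPairs R (soleNonNbrs R V c i)) : ℝ) ≤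
        (#V : ℝ) ^ 2 - (r + 1) * #V * ((#(cliques R V (r + 1)) : ℝ) / #(cliques R V r))
          + 2 * (r + 1) * #V * ((#(cliques R V (r + 2)) : ℝ) / #(cliques R V (r + 1))) := by
  have hne : (cliques R V (r + 1)).Nonempty := card_pos.1 hpos
  have hh : (0 : ℝ) < #(cliques R V (r + 1)) := by exact_mod_cast hpos
  have hh0 : (0 : ℝ) < #(cliques R V r) := by
    rcases Nat.eq_zero_or_pos #(cliques R V r) with h | h
    · rw [card_cliques_succ hR, card_eq_zero.1 h] at hpos
      simp at hpos
    · exact_mod_cast h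
  have h1 : (#(cliques R V (r + 1)) : ℝ) ^ 2 ≤
      #(cliques R V r) * ∑ e ∈ cliques R V r, (#(commonNbrs R V e) : ℝ) ^ 2 := by
    exact_mod_cast card_cliques_succ_sq_le (V := V) hR r
  have h2 : ∑ c ∈ cliques R V (r + 1), ∑ i, (#(soleNonNbrs R V c i) : ℝ)
      + (r + 1) * #(cliques R V (r + 2)) =
      (r + 1) * ∑ e ∈ cliques R V r, (#(commonNbrs R V e) : ℝ) ^ 2 := by
    exact_mod_cast sum_sum_soleNonNbrs (V := V) hR r
  have h3 : ∑ c ∈ cliques R V (r + 1), ∑ i, (#(relPairs R (soleNonNbrs R V c i)) : ℝ) ≤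
      (r + 1) * (#V * #(cliques R V (r + 2))) := by
    rw [sum_comm]
    calc _ ≤ ∑ _i : Fin (r + 1), (#V * #(cliques R V (r + 2)) : ℝ) := by
          refine sum_le_sum fun i _ => ?_
          have h := sum_relPairs_commonNbrs_le (V := V) hR i
          refine le_trans ?_ ((Nat.cast_le (α := ℝ)).2 h |>.trans_eq (Nat.cast_mul _ _))
          rw [Nat.cast_sum]
          refine sum_le_sum fun c _ => Nat.cast_le.2 ?_
          refine card_le_card (filter_subset_filter _ (product_subset_product ?_ ?_)) <;>
          · intro v hv
            rw [mem_soleNonNbrs] at hv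
            exact mem_commonNbrs.2 ⟨hv.1, fun j => (hv.2 _).2 (Fin.succAbove_ne i j)⟩
      _ = _ := by simp
  refine exists_le_of_sum_le hne ?_
  rw [sum_const, nsmul_eq_mul, sum_add_distrib, ← sum_mul, sum_sub_distrib, sum_const,
    nsmul_eq_mul]
  have h4 : (#(cliques R V (r + 1)) : ℝ) * (#(cliques R V (r + 1)) / #(cliques R V r)) ≤
      ∑ e ∈ cliques R V r, (#(commonNbrs R V e) : ℝ) ^ 2 := by
    rw [← mul_div_assoc, div_le_iff₀ hh0]
    linarith
  have h5 : (#(cliques R V (r + 1)) : ℝ) * (#(cliques R V (r + 2)) / #(cliques R V (r + 1))) =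
      #(cliques R V (r + 2)) := by field_simp
  have h6 : 0 ≤ ((r : ℝ) + 1) * #V := by positivity
  have h7 := mul_le_mul_of_nonneg_left h4 h6
  have h8 := congrArg (· * (#V : ℝ)) h2
  have h9 := congrArg (· * (2 * ((r : ℝ) + 1) * #V)) h5
  nlinarith

end Cliques

/-- A downward induction on Moon–Moser ratios: if `h` satisfies the Moon–Moser inequalities and
`h (k + 1)` is small compared to `h k`, then every ratio `h (r + 1) / h r` is at most about what
it is in the complete `k`-partite graph. -/
theorem ratio_le_of_moon_moser {h : ℕ → ℝ} {m δ : ℝ} {k : ℕ} (hk : 0 < k) (hm : 0 ≤ m)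
    (hδ : 0 ≤ δ) (hpos : ∀ r ≤ k, 0 < h r)
    (hmm : ∀ r, (r + 1) * h (r + 1) ^ 2 ≤ h r * (m * h (r + 1) + r * h (r + 2)))
    (hlast : h (k + 1) ≤ m * δ * h k) (r : ℕ) (hr : r ≤ k) :
    h (r + 1) ≤ m * ((k - r) / k + δ) * h r := by
  have hk' : (0 : ℝ) < k := by exact_mod_cast hk
  refine Nat.decreasingInduction (motive := fun r _ => h (r + 1) ≤ m * ((k - r) / k + δ) * h r)
    ?_ ?_ hr
  · intro s hs ih
    have hs1 := hpos (s + 1) hs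
    have hs0 := hpos s hs.le
    have h1 : (s + 1) * h (s + 1) ^ 2 ≤
        h s * (m * h (s + 1) + s * (m * ((k - (s + 1 : ℕ)) / k + δ) * h (s + 1))) := by
      refine (hmm s).trans ?_
      gcongr
    have h2 : (s + 1) * h (s + 1) ≤ h s * (m + s * (m * ((k - (s + 1 : ℕ)) / k + δ))) := by
      refine le_of_mul_le_mul_right ?_ hs1
      calc _ = (s + 1) * h (s + 1) ^ 2 := by ring
        _ ≤ _ := h1
        _ = _ := by ring
    have h3 : h s * (m + s * (m * ((k - (s + 1 : ℕ)) / k + δ))) ≤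
        (s + 1) * (m * ((k - s) / k + δ) * h s) := by
      have : (s + 1) * (m * ((k - s) / k + δ) * h s) -
          h s * (m + s * (m * ((k - (s + 1 : ℕ)) / k + δ))) = h s * m * δ := by
        push_cast; field_simp; ring
      have : 0 ≤ h s * m * δ := by positivity
      linarith
    exact le_of_mul_le_mul_left (h2.trans h3) (by positivity)
  · simpa using hlast

/-- The product of the ratios: there are hardly more `r`-cliques than in the balanced complete
`k`-partite relation, which has `(m / k) ^ r * k.descFactorial r` of them. -/
theorem le_of_moon_moser {h : ℕ → ℝ} {m δ : ℝ} {k : ℕ} (hk : 0 < k) (hm : 0 ≤ m)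
    (hδ : 0 ≤ δ) (h0 : h 0 = 1) (hpos : ∀ r ≤ k, 0 < h r)
    (hmm : ∀ r, (r + 1) * h (r + 1) ^ 2 ≤ h r * (m * h (r + 1) + r * h (r + 2)))
    (hlast : h (k + 1) ≤ m * δ * h k) (r : ℕ) (hr : r ≤ k) :
    h r ≤ (m / k * (1 + k * δ)) ^ r * k.descFactorial r := by
  have hk' : (0 : ℝ) < k := by exact_mod_cast hk
  induction r with
  | zero => simp [h0]
  | succ s ih =>
    have h1 := ratio_le_of_moon_moser hk hm hδ hpos hmm hlast s (by omega)
    have h2 := ih (by omega)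
    have h3 : (1 : ℝ) ≤ (k - s : ℕ) := by exact_mod_cast (by omega : 1 ≤ k - s)
    have h4 : ((k - s : ℕ) : ℝ) = k - s := by rw [Nat.cast_sub (by omega)]
    calc h (s + 1) ≤ m * ((k - s) / k + δ) * h s := h1
      _ ≤ (m / k * (1 + k * δ) * (k - s : ℕ)) * h s := by
        refine mul_le_mul_of_nonneg_right ?_ (hpos s (by omega)).le
        have : m / k * (1 + k * δ) * (k - s : ℕ) - m * ((k - s) / k + δ) =
            m * δ * ((k - s : ℕ) - 1) := by
          rw [h4]; field_simp; ring
        have : 0 ≤ m * δ * (((k - s : ℕ) : ℝ) - 1) := by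
          have : 0 ≤ ((k - s : ℕ) : ℝ) - 1 := by linarith
          positivity
        linarith
      _ ≤ (m / k * (1 + k * δ) * (k - s : ℕ)) * ((m / k * (1 + k * δ)) ^ s * k.descFactorial s) := by
        gcongr
      _ = _ := by
        rw [Nat.descFactorial_succ]; push_cast; ring

/-! ### Few `(k + 1)`-tuples of pairwise disjoint sets in a large family -/

section Disjoint
variable {X : Type*} [DecidableEq X]

/-- A tuple of `t` sets from `V` has a small union only if all its entries lie in a common small
set, so the number of such tuples is at most `2 ^ n * (2 ^ s) ^ t`. -/
theorem card_small_union_le [Fintype X] (V : Finset (Finset X)) (s t : ℕ) :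
    #{v ∈ Fintype.piFinset fun _ : Fin t => V | #(univ.biUnion v) ≤ s} ≤
      2 ^ Fintype.card X * (2 ^ s) ^ t := by
  have h : {v ∈ Fintype.piFinset fun _ : Fin t => V | #(univ.biUnion v) ≤ s} ⊆
      ({Z : Finset X | #Z ≤ s} : Finset (Finset X)).biUnion
        fun Z => Fintype.piFinset fun _ : Fin t => Z.powerset := by
    intro v hv
    simp only [mem_filter, Fintype.mem_piFinset] at hv
    simp only [mem_biUnion, mem_filter, mem_univ, true_and, Fintype.mem_piFinset, mem_powerset]
    exact ⟨_, hv.2, fun p => subset_biUnion_of_mem v (mem_univ p)⟩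
  refine (card_le_card h).trans (card_biUnion_le.trans ?_)
  calc ∑ Z ∈ ({Z : Finset X | #Z ≤ s} : Finset (Finset X)),
        #(Fintype.piFinset fun _ : Fin t => Z.powerset)
      ≤ ∑ Z ∈ ({Z : Finset X | #Z ≤ s} : Finset (Finset X)), (2 ^ s) ^ t := by
        refine sum_le_sum fun Z hZ => ?_
        rw [Fintype.card_piFinset_const, card_powerset]
        have : #Z ≤ s := by simpa using hZ
        gcongr
        norm_num
    _ ≤ _ := by
        rw [sum_const, smul_eq_mul]
        gcongr
        refine (card_filter_le _ _).trans ?_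
        simp

/-- Double counting pairs of an ordered `r`-clique `w` and a `t`-tuple `v` of sets disjoint from
all entries of `w`: such a `w` avoids the union of `v`. -/
theorem sum_card_commonNbrs_pow_le (V : Finset (Finset X)) (Y : Finset X) (r t : ℕ) :
    ∑ w ∈ cliques Disjoint {v ∈ V | v ⊆ Y} r, #(commonNbrs Disjoint {v ∈ V | v ⊆ Y} w) ^ t ≤
      ∑ v ∈ Fintype.piFinset fun _ : Fin t => {v ∈ V | v ⊆ Y},
        #(cliques Disjoint {u ∈ V | u ⊆ Y \ univ.biUnion v} r) := by
  have h1 : ∀ w : Fin r → Finset X, #(commonNbrs Disjoint {v ∈ V | v ⊆ Y} w) ^ t =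
      #(Fintype.piFinset fun _ : Fin t => commonNbrs Disjoint {v ∈ V | v ⊆ Y} w) := by
    simp
  simp_rw [h1]
  rw [← card_sigma, ← card_sigma]
  refine card_le_card_of_injOn (fun p => ⟨p.2, p.1⟩) ?_ ?_
  · rintro ⟨w, v⟩ h
    simp only [coe_sigma, Set.mem_sigma_iff, mem_coe, mem_cliques, Fintype.mem_piFinset,
      mem_commonNbrs, mem_filter] at h ⊢
    refine ⟨fun p => (h.2 p).1, fun i => ⟨(h.1.1 i).1, ?_⟩, h.1.2⟩
    rw [subset_sdiff, disjoint_biUnion_right]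
    exact ⟨(h.1.1 i).2, fun p _ => ((h.2 p).2 i).symm⟩
  · rintro ⟨w, v⟩ _ ⟨w', v'⟩ _ h
    simp only [Sigma.mk.injEq, heq_eq_eq] at h
    simp [h.1, h.2]

/-- The inductive step of `card_cliques_subset_le` in terms of numbers: `a` and `b` count the
`(r + 1)`- and `r`-cliques, and `c` the pairs of an `r`-clique and a tuple disjoint from it. -/
theorem le_of_power_mean {a b c m z : ℝ} {q r : ℕ} (hb : 0 ≤ b) (hz : 0 ≤ z) {r' : ℝ}
    (hr : 0 ≤ r') (hm : 0 ≤ m) (hbm : b ≤ m ^ r)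
    (hc : c ≤ (r' + 1) * z ^ (q + 1) * m ^ r * m ^ (q + 1)) (ha : a ^ (q + 1) ≤ b ^ q * c) :
    a ≤ (r' + 1) * (z * m ^ (r + 1)) := by
  refine le_of_pow_le_pow_left₀ (n := q + 1) (by omega) (by positivity) ?_
  calc a ^ (q + 1) ≤ b ^ q * c := ha
    _ ≤ b ^ q * ((r' + 1) * z ^ (q + 1) * m ^ r * m ^ (q + 1)) := by gcongr
    _ ≤ (m ^ r) ^ q * ((r' + 1) * z ^ (q + 1) * m ^ r * m ^ (q + 1)) := by gcongr
    _ = (r' + 1) * (z * m ^ (r + 1)) ^ (q + 1) := by ring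
    _ ≤ (r' + 1) ^ (q + 1) * (z * m ^ (r + 1)) ^ (q + 1) := by
      gcongr
      exact le_self_pow₀ (by linarith) (by omega)
    _ = _ := by rw [← mul_pow]

/-- If almost all `t`-tuples of members of `V` have a union of more than `s` elements, then there
are few `r`-tuples of pairwise disjoint members of `V` inside a set with fewer than `r * (s + 1)`
elements. The induction removes from `Y` the union of a random `t`-tuple. -/
theorem card_cliques_subset_le (V : Finset (Finset X)) {s t K : ℕ} {ρ : ℝ} (ht : 1 ≤ t)
    (hρ : 0 ≤ ρ) (hρ1 : ρ ≤ 1)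
    (hbad : (#{v ∈ Fintype.piFinset fun _ : Fin t => V | #(univ.biUnion v) ≤ s} : ℝ) ≤
      ρ ^ t ^ K * (#V : ℝ) ^ t) (r : ℕ) (hr : r ≤ K) (Y : Finset X) (hY : #Y < r * (s + 1)) :
    (#(cliques Disjoint {v ∈ V | v ⊆ Y} r) : ℝ) ≤ r * ρ ^ t ^ (K - r) * (#V : ℝ) ^ r := by
  induction r generalizing Y with
  | zero => simp at hY
  | succ r ih =>
    set W := {v ∈ V | v ⊆ Y} with hW
    have hWV : #W ≤ #V := card_filter_le _ _
    obtain ⟨q, rfl⟩ : ∃ q, t = q + 1 := ⟨t - 1, by omega⟩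
    have hsum : (∑ v ∈ Fintype.piFinset fun _ : Fin (q + 1) => W,
        (#(cliques Disjoint {u ∈ V | u ⊆ Y \ univ.biUnion v} r) : ℝ)) ≤
        (r + 1) * ρ ^ (q + 1) ^ (K - r) * (#V : ℝ) ^ r * (#V : ℝ) ^ (q + 1) := by
      rw [← sum_filter_add_sum_filter_not _ fun v => #(univ.biUnion v) ≤ s]
      have hA : ∑ v ∈ (Fintype.piFinset fun _ : Fin (q + 1) => W) with #(univ.biUnion v) ≤ s,
          (#(cliques Disjoint {u ∈ V | u ⊆ Y \ univ.biUnion v} r) : ℝ) ≤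
          ρ ^ (q + 1) ^ (K - r) * (#V : ℝ) ^ (q + 1) * (#V : ℝ) ^ r := by
        calc _ ≤ ∑ v ∈ (Fintype.piFinset fun _ : Fin (q + 1) => W) with #(univ.biUnion v) ≤ s,
                (#V : ℝ) ^ r := by
              refine sum_le_sum fun v _ => ?_
              refine le_trans (Nat.cast_le.2 (card_cliques_le r)) ?_
              push_cast
              gcongr
              exact filter_subset _ _
          _ ≤ ρ ^ (q + 1) ^ K * (#V : ℝ) ^ (q + 1) * (#V : ℝ) ^ r := by
              rw [sum_const, nsmul_eq_mul]
              gcongr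
              refine le_trans (Nat.cast_le.2 (card_le_card ?_)) hbad
              refine filter_subset_filter _ (Fintype.piFinset_subset _ _ fun _ => filter_subset _ _)
          _ ≤ _ := by
              gcongr ?_ * _ * _
              exact pow_le_pow_of_le_one hρ hρ1 (Nat.pow_le_pow_right (by omega) (by omega))
      have hB : ∑ v ∈ (Fintype.piFinset fun _ : Fin (q + 1) => W) with ¬ #(univ.biUnion v) ≤ s,
          (#(cliques Disjoint {u ∈ V | u ⊆ Y \ univ.biUnion v} r) : ℝ) ≤
          (#V : ℝ) ^ (q + 1) * (r * ρ ^ (q + 1) ^ (K - r) * (#V : ℝ) ^ r) := by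
        calc _ ≤ ∑ v ∈ (Fintype.piFinset fun _ : Fin (q + 1) => W) with ¬ #(univ.biUnion v) ≤ s,
                (r * ρ ^ (q + 1) ^ (K - r) * (#V : ℝ) ^ r) := by
              refine sum_le_sum fun v hv => ih (by omega) _ ?_
              simp only [mem_filter, Fintype.mem_piFinset, hW] at hv
              have hvY : univ.biUnion v ⊆ Y := biUnion_subset.2 fun p _ => (hv.1 p).2
              have := card_le_card hvY
              rw [card_sdiff_of_subset hvY]
              rw [Nat.succ_mul] at hY
              omega
          _ ≤ _ := by
              rw [sum_const, nsmul_eq_mul]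
              gcongr
              have : #{v ∈ Fintype.piFinset fun _ : Fin (q + 1) => W | ¬ #(univ.biUnion v) ≤ s} ≤
                  #V ^ (q + 1) := by
                refine (card_filter_le _ _).trans ?_
                rw [Fintype.card_piFinset_const]
                gcongr
              exact_mod_cast this
      linarith
    have hmean : (#(cliques Disjoint W (r + 1)) : ℝ) ^ (q + 1) ≤
        (#(cliques Disjoint W r) : ℝ) ^ q *
          ∑ w ∈ cliques Disjoint W r, (#(commonNbrs Disjoint W w) : ℝ) ^ (q + 1) := by
      rw [card_cliques_succ (fun _ _ h => h.symm), Nat.cast_sum]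
      rcases (cliques Disjoint W r).eq_empty_or_nonempty with h | h
      · simp [h]
      · have := pow_sum_div_card_le_sum_pow (s := cliques Disjoint W r)
          (f := fun w => (#(commonNbrs Disjoint W w) : ℝ)) (fun _ _ => by positivity) q
        rwa [div_le_iff₀' (pow_pos (Nat.cast_pos.2 (card_pos.2 h)) q)] at this
    have hdc : (∑ w ∈ cliques Disjoint W r, (#(commonNbrs Disjoint W w) : ℝ) ^ (q + 1)) ≤
        ∑ v ∈ Fintype.piFinset fun _ : Fin (q + 1) => W,
        (#(cliques Disjoint {u ∈ V | u ⊆ Y \ univ.biUnion v} r) : ℝ) := by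
      exact_mod_cast sum_card_commonNbrs_pow_le V Y r (q + 1)
    have hcl : (#(cliques Disjoint W r) : ℝ) ≤ (#V : ℝ) ^ r := by
      have : #(cliques Disjoint W r) ≤ #V ^ r :=
        (card_cliques_le r).trans (Nat.pow_le_pow_left hWV r)
      exact_mod_cast this
    have hz : ρ ^ (q + 1) ^ (K - r) = (ρ ^ (q + 1) ^ (K - (r + 1))) ^ (q + 1) := by
      rw [← pow_mul, ← pow_succ, show K - r = K - (r + 1) + 1 by omega]
    have hz0 : 0 ≤ ρ ^ (q + 1) ^ (K - (r + 1)) := pow_nonneg hρ _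
    rw [hz] at hsum
    generalize ρ ^ (q + 1) ^ (K - (r + 1)) = z at hsum hz0 ⊢
    rw [Nat.cast_succ, mul_assoc]
    exact le_of_power_mean (Nat.cast_nonneg _) hz0 (Nat.cast_nonneg r) (Nat.cast_nonneg _) hcl
      (hdc.trans hsum) hmean

/-- A family of at least `2 ^ q / 2` subsets of a set with `k * q` elements has exponentially few
`(k + 1)`-tuples of pairwise disjoint members. -/
theorem exists_card_cliques_le (k : ℕ) (hk : 1 ≤ k) :
    ∃ K ξ : ℝ, 0 < K ∧ 0 < ξ ∧ ∀ (X : Type*) [Fintype X] [DecidableEq X] (q : ℕ),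
      Fintype.card X = k * q → ∀ V : Finset (Finset X), (2 : ℝ) ^ q ≤ 2 * #V →
      (#(cliques Disjoint V (k + 1)) : ℝ) ≤
        K * (2 : ℝ) ^ (-(ξ * (Fintype.card X : ℝ))) * (#V : ℝ) ^ (k + 1) := by
  -- with this `t`, the factor `(2 ^ (n / (k + 1)) / 2 ^ q) ^ t` is `2 ^ (-2 * n)`
  obtain ⟨t, ht⟩ : ∃ t, t = 2 * k * (k + 1) := ⟨_, rfl⟩
  have ht1 : 1 ≤ t := by rw [ht]; nlinarith
  set T : ℕ := t ^ (k + 1) with hT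
  have hT0 : 0 < T := by positivity
  refine ⟨(k + 1) * 2 ^ (t : ℝ), 1 / T, by positivity, by positivity, ?_⟩
  intro X _ _ q hX V hV
  set n := Fintype.card X with hn
  set s := n / (k + 1) with hs
  -- the tuples with small union have density at most `2 ^ (t - n)`
  have hbad : (#{v ∈ Fintype.piFinset fun _ : Fin t => V | #(univ.biUnion v) ≤ s} : ℝ) ≤
      (2 : ℝ) ^ ((t : ℝ) - n) * (#V : ℝ) ^ t := by
    have h1 : (#{v ∈ Fintype.piFinset fun _ : Fin t => V | #(univ.biUnion v) ≤ s} : ℝ) ≤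
        2 ^ n * (2 ^ s) ^ t := by exact_mod_cast card_small_union_le V s t
    refine h1.trans ?_
    have h2 : s * t ≤ 2 * k * n := by
      have : s * (k + 1) ≤ n := Nat.div_mul_le_self n (k + 1)
      rw [ht]; nlinarith
    have h3 : ((2 : ℝ) ^ q) ^ t ≤ 2 ^ t * (#V : ℝ) ^ t := by
      rw [← mul_pow]; gcongr
    have h4 : q * t = 2 * k * n + 2 * n := by rw [ht, hX]; ring
    rw [Real.rpow_sub (by norm_num), Real.rpow_natCast, Real.rpow_natCast, div_mul_eq_mul_div,
      le_div_iff₀ (by positivity)]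
    refine le_trans ?_ h3
    rw [← pow_mul, ← pow_mul, ← pow_add, ← pow_add]
    exact pow_le_pow_right₀ (by norm_num) (by omega)
  have hY : #(univ : Finset X) < (k + 1) * (s + 1) := by
    rw [card_univ, ← hn, hs]
    exact Nat.lt_mul_div_succ n (by omega)
  have hcl : (#(cliques Disjoint V (k + 1)) : ℝ) ≤ (#V : ℝ) ^ (k + 1) := by
    exact_mod_cast card_cliques_le (R := Disjoint) (V := V) (k + 1)
  have hk0 : (0 : ℝ) ≤ k := by positivity
  rcases le_or_gt (n : ℝ) t with hnt | hnt
  · -- for `n ≤ t` the right-hand side exceeds the trivial bound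
    refine hcl.trans (le_mul_of_one_le_left (by positivity) ?_)
    rw [mul_assoc, ← Real.rpow_add (by norm_num)]
    have h5 : (1 : ℝ) ≤ 2 ^ ((t : ℝ) + -(1 / T * n)) := by
      refine Real.one_le_rpow (by norm_num) ?_
      have : 1 / (T : ℝ) * n ≤ 1 * n := by
        gcongr
        rw [div_le_one (by positivity)]
        exact_mod_cast hT0
      linarith
    nlinarith
  · set ρ : ℝ := (2 : ℝ) ^ (((t : ℝ) - n) / T) with hρ
    have hρT : ρ ^ T = (2 : ℝ) ^ ((t : ℝ) - n) := by
      rw [hρ, ← Real.rpow_natCast, ← Real.rpow_mul (by norm_num), div_mul_cancel₀ _ (by positivity)]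
    have hmain := card_cliques_subset_le V (K := k + 1) (ρ := ρ) ht1 (by positivity)
      (Real.rpow_le_one_of_one_le_of_nonpos (by norm_num)
        (div_nonpos_of_nonpos_of_nonneg (by linarith) (by positivity)))
      (by rw [← hT, hρT]; exact hbad) (k + 1) le_rfl univ hY
    simp only [subset_univ, filter_true, Nat.sub_self, pow_zero, pow_one] at hmain
    refine hmain.trans ?_
    push_cast
    gcongr ?_ * _
    rw [mul_assoc, ← Real.rpow_add (by norm_num)]
    refine mul_le_mul_of_nonneg_left ?_ (by positivity)
    refine Real.rpow_le_rpow_of_exponent_le (by norm_num) ?_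
    have : (t : ℝ) / T ≤ t := div_le_self (by positivity) (by exact_mod_cast hT0)
    rw [sub_div, one_div_mul_eq_div]
    linarith

end Disjoint

/-! ### Recovering the partition from the element frequencies -/

section Frequency
variable {X : Type*} [DecidableEq X] {k : ℕ}

/-- The tuples of pairwise disjoint sets that have their `i`-th entry in `B i`. -/
def transversals (B : Fin k → Finset (Finset X)) : Finset (Fin k → Finset X) :=
  {a ∈ Fintype.piFinset B | ∀ i j, i ≠ j → Disjoint (a i) (a j)}

/-- If almost all subsets of `X` are unions of transversals of `B`, and there are hardly more
transversals than that, then every `x` lies in a constant proportion of some `B i`: otherwise too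
few of the unions would contain `x`. -/
theorem exists_heavy [Fintype X] (B : Fin k → Finset (Finset X)) {F : Finset (Finset X)} {γ : ℝ}
    (hγ : γ ≤ 1 / 8) (hF : (1 - γ) * 2 ^ Fintype.card X ≤ (#F : ℝ))
    (hB : ∏ i, (#(B i) : ℝ) ≤ (1 + γ) * 2 ^ Fintype.card X)
    (hFB : F ⊆ (transversals B).image fun a => univ.biUnion a) (x : X) :
    ∃ i, (#(B i) : ℝ) ≤ 4 * k * #{b ∈ B i | x ∈ b} := by
  by_contra! hcon
  have h2 : (0 : ℝ) < 2 ^ Fintype.card X := by positivity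
  have hsub : F ⊆ (univ.erase x).powerset ∪ (univ.biUnion fun i =>
      {a ∈ Fintype.piFinset B | a i ∈ {b ∈ B i | x ∈ b}}).image fun a => univ.biUnion a := by
    intro y hy
    by_cases hx : x ∈ y
    · refine mem_union_right _ ?_
      obtain ⟨a, ha, rfl⟩ := mem_image.1 (hFB hy)
      obtain ⟨i, -, hi⟩ := mem_biUnion.1 hx
      have ha' := (mem_filter.1 ha).1
      exact mem_image_of_mem _ (mem_biUnion.2 ⟨i, mem_univ i, mem_filter.2
        ⟨ha', mem_filter.2 ⟨Fintype.mem_piFinset.1 ha' i, hi⟩⟩⟩)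
    · refine mem_union_left _ (mem_powerset.2 fun z hz => mem_erase.2 ⟨?_, mem_univ z⟩)
      rintro rfl
      exact hx hz
  have hcard : (#F : ℝ) ≤ 2 ^ (Fintype.card X - 1) +
      ∑ i, (#{a ∈ Fintype.piFinset B | a i ∈ {b ∈ B i | x ∈ b}} : ℝ) := by
    have h := (card_le_card hsub).trans ((card_union_le _ _).trans
      (add_le_add_right (card_image_le.trans card_biUnion_le) _))
    rw [card_powerset, card_erase_of_mem (mem_univ x), card_univ] at h
    exact_mod_cast h
  have hhalf : (2 : ℝ) ^ (Fintype.card X - 1) = 2 ^ Fintype.card X / 2 := by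
    have : 0 < Fintype.card X := Fintype.card_pos_iff.2 ⟨x⟩
    rw [eq_div_iff (by norm_num), ← pow_succ, Nat.sub_add_cancel this]
  have hterm : ∀ i, (k : ℝ) * #{a ∈ Fintype.piFinset B | a i ∈ {b ∈ B i | x ∈ b}} ≤
      (∏ l, (#(B l) : ℝ)) / 4 := by
    intro i
    have hbi : (0 : ℝ) < #(B i) :=
      lt_of_le_of_lt (mul_nonneg (by positivity) (Nat.cast_nonneg _)) (hcon i)
    have h1 : (#{a ∈ Fintype.piFinset B | a i ∈ {b ∈ B i | x ∈ b}} : ℝ) * #(B i) =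
        #{b ∈ B i | x ∈ b} * ∏ l, (#(B l) : ℝ) := by
      exact_mod_cast card_piFinset_filter_mem_mul B i _ (filter_subset _ _)
    have hP : 0 ≤ ∏ l, (#(B l) : ℝ) := prod_nonneg fun _ _ => Nat.cast_nonneg _
    refine le_of_mul_le_mul_right ?_ hbi
    nlinarith [mul_le_mul_of_nonneg_right (hcon i).le hP]
  have hk : (0 : ℝ) < k := by
    rcases Nat.eq_zero_or_pos k with rfl | h
    · simp only [univ_eq_empty, sum_empty, add_zero] at hcard
      nlinarith
    · exact_mod_cast h
  have hsum : ∑ i, (#{a ∈ Fintype.piFinset B | a i ∈ {b ∈ B i | x ∈ b}} : ℝ) ≤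
      (∏ l, (#(B l) : ℝ)) / 4 := by
    have := sum_le_sum fun i (_ : i ∈ univ) => hterm i
    rw [← mul_sum, sum_const, card_univ, Fintype.card_fin, nsmul_eq_mul] at this
    exact le_of_mul_le_mul_left this hk
  nlinarith

/-- A member of `B i` which meets a set `T` of elements that are frequent in `B j` intersects a
constant proportion of `B j`; so there are few such members if almost all tuples in the product of
the `B l` consist of disjoint sets. -/
theorem card_not_disjoint_mul_le (B : Fin k → Finset (Finset X)) {i j : Fin k} (hij : i ≠ j)
    (T : Finset X) (hT : ∀ x ∈ T, (#(B j) : ℝ) ≤ 4 * k * #{b ∈ B j | x ∈ b})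
    (hpos : ∀ l, 0 < #(B l)) :
    (#{b ∈ B i | ¬ Disjoint b T} : ℝ) * ∏ l, (#(B l) : ℝ) ≤
      4 * k * (∏ l, (#(B l) : ℝ) - #(transversals B)) * #(B i) := by
  set E : Finset (Finset X × Finset X) := {p ∈ B i ×ˢ B j | ¬ Disjoint p.1 p.2} with hE
  have hbj : (0 : ℝ) < #(B j) := by exact_mod_cast hpos j
  have h1 : (#{a ∈ Fintype.piFinset B | (a i, a j) ∈ E} : ℝ) * (#(B i) * #(B j)) =
      #E * ∏ l, (#(B l) : ℝ) := by
    exact_mod_cast card_piFinset_filter_pair_mul B hij E (filter_subset _ _)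
  have h2 : (#{a ∈ Fintype.piFinset B | (a i, a j) ∈ E} : ℝ) + #(transversals B) ≤
      ∏ l, (#(B l) : ℝ) := by
    have hd : Disjoint {a ∈ Fintype.piFinset B | (a i, a j) ∈ E} (transversals B) := by
      rw [disjoint_left]
      intro a ha ha'
      exact (mem_filter.1 (mem_filter.1 ha).2).2 ((mem_filter.1 ha').2 i j hij)
    have := card_le_card (union_subset (filter_subset _ _) (filter_subset _ _) :
      {a ∈ Fintype.piFinset B | (a i, a j) ∈ E} ∪ transversals B ⊆ Fintype.piFinset B)
    rw [card_union_of_disjoint hd, Fintype.card_piFinset] at this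
    exact_mod_cast this
  have h3 : (#{b ∈ B i | ¬ Disjoint b T} : ℝ) * #(B j) ≤ 4 * k * #E := by
    have hEc : #E = ∑ b ∈ B i, #{c ∈ B j | ¬ Disjoint b c} := by
      rw [hE, card_filter, sum_product]
      simp [card_filter]
    rw [hEc, Nat.cast_sum, mul_sum, ← nsmul_eq_mul, ← sum_const]
    refine (sum_le_sum fun b hb => ?_).trans (sum_le_sum_of_subset_of_nonneg (filter_subset _ _)
      fun _ _ _ => mul_nonneg (by positivity) (Nat.cast_nonneg _))
    obtain ⟨x, hxb, hxT⟩ := not_disjoint_iff.1 (mem_filter.1 hb).2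
    refine (hT x hxT).trans (mul_le_mul_of_nonneg_left (Nat.cast_le.2 (card_le_card ?_))
      (by positivity))
    intro c hc
    rw [mem_filter] at hc ⊢
    exact ⟨hc.1, not_disjoint_iff.2 ⟨x, hxb, hc.2⟩⟩
  have hP : 0 ≤ ∏ l, (#(B l) : ℝ) := prod_nonneg fun _ _ => Nat.cast_nonneg _
  refine le_of_mul_le_mul_right ?_ hbj
  generalize #{a ∈ Fintype.piFinset B | (a i, a j) ∈ E} = A at h1 h2
  generalize #{b ∈ B i | ¬ Disjoint b T} = D at h3 ⊢
  generalize ∏ l, (#(B l) : ℝ) = P at h1 h2 hP ⊢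
  generalize #(transversals B) = T' at h2 ⊢
  calc _ = (D : ℝ) * #(B j) * P := by ring
    _ ≤ 4 * k * #E * P := by gcongr
    _ = 4 * k * (A : ℝ) * #(B i) * #(B j) := by
      rw [mul_assoc, ← h1]; ring
    _ ≤ 4 * k * (P - T') * #(B i) * #(B j) := by
      gcongr
      linarith

/-- Assigning each element of `X` to some `B i` in which it is frequent gives a partition of `X` for
which almost every member of `B i` lies inside the `i`-th class. -/
theorem exists_partition_of_transversals [Fintype X] (B : Fin k → Finset (Finset X))
    {F : Finset (Finset X)} {γ : ℝ} (hγ0 : 0 ≤ γ)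
    (hγ : γ ≤ 1 / 8) (hF : (1 - γ) * 2 ^ Fintype.card X ≤ (#F : ℝ))
    (hB : ∏ i, (#(B i) : ℝ) ≤ (1 + γ) * 2 ^ Fintype.card X)
    (hFB : F ⊆ (transversals B).image fun a => univ.biUnion a) :
    ∃ S : Fin k → Finset X, Pairwise (fun i j => Disjoint (S i) (S j)) ∧
      univ.biUnion S = univ ∧
      ∀ i, (1 - 16 * k ^ 2 * γ) * #(B i) ≤ (#{b ∈ B i | b ⊆ S i} : ℝ) := by
  choose f hf using exists_heavy B hγ hF hB hFB
  have hFT : (#F : ℝ) ≤ #(transversals B) := by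
    exact_mod_cast (card_le_card hFB).trans card_image_le
  have h2 : (0 : ℝ) < 2 ^ Fintype.card X := by positivity
  have hTP : (#(transversals B) : ℝ) ≤ ∏ l, (#(B l) : ℝ) := by
    have : #(transversals B) ≤ ∏ l, #(B l) :=
      (card_filter_le _ _).trans_eq (Fintype.card_piFinset _)
    exact_mod_cast this
  have hP : 0 < ∏ l, (#(B l) : ℝ) := by nlinarith
  have hpos : ∀ l, 0 < #(B l) := fun l => by
    have := prod_ne_zero_iff.1 hP.ne' l (mem_univ l)
    exact Nat.pos_of_ne_zero (by exact_mod_cast this)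
  refine ⟨fun i => {x | f x = i}, fun i j hij => ?_, ?_, fun i => ?_⟩
  · refine disjoint_left.2 fun x hx hx' => ?_
    simp only [mem_filter, mem_univ, true_and] at hx hx'
    exact hij (hx.symm.trans hx')
  · ext x; simp
  · have hbi : (0 : ℝ) < #(B i) := by exact_mod_cast hpos i
    have hbad : ∀ j ∈ univ.erase i,
        (#{b ∈ B i | ¬ Disjoint b ({x | f x = j} : Finset X)} : ℝ) ≤ 16 * k * γ * #(B i) := by
      intro j hj
      have h := card_not_disjoint_mul_le B (ne_of_mem_erase hj).symm {x | f x = j}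
        (fun x hx => by
          have hx' : f x = j := by simpa using hx
          rw [← hx']; exact hf x) hpos
      refine le_of_mul_le_mul_right (h.trans ?_) hP
      have h4 : ∏ l, (#(B l) : ℝ) - #(transversals B) ≤ 4 * γ * ∏ l, (#(B l) : ℝ) := by
        nlinarith
      calc _ ≤ 4 * k * (4 * γ * ∏ l, (#(B l) : ℝ)) * #(B i) := by gcongr
        _ = _ := by ring
    have hcov : B i ⊆ {b ∈ B i | b ⊆ ({x | f x = i} : Finset X)} ∪ (univ.erase i).biUnion
        fun j => {b ∈ B i | ¬ Disjoint b ({x | f x = j} : Finset X)} := by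
      intro b hb
      by_cases hbS : b ⊆ ({x | f x = i} : Finset X)
      · exact mem_union_left _ (mem_filter.2 ⟨hb, hbS⟩)
      · obtain ⟨x, hxb, hx⟩ := not_subset.1 hbS
        refine mem_union_right _ (mem_biUnion.2 ⟨f x, mem_erase.2 ⟨?_, mem_univ _⟩,
          mem_filter.2 ⟨hb, not_disjoint_iff.2 ⟨x, hxb, by simp⟩⟩⟩)
        simpa using hx
    have hc : (#(B i) : ℝ) ≤ #{b ∈ B i | b ⊆ ({x | f x = i} : Finset X)} +
        ∑ j ∈ univ.erase i, (#{b ∈ B i | ¬ Disjoint b ({x | f x = j} : Finset X)} : ℝ) := by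
      exact_mod_cast (card_le_card hcov).trans ((card_union_le _ _).trans
        (add_le_add_right card_biUnion_le _))
    have hs : ∑ j ∈ univ.erase i, (#{b ∈ B i | ¬ Disjoint b ({x | f x = j} : Finset X)} : ℝ) ≤
        k * (16 * k * γ * #(B i)) := by
      refine (sum_le_sum hbad).trans ?_
      rw [sum_const, nsmul_eq_mul]
      gcongr
      simp
    linarith

end Frequency

/-! ### From generated sets to transversals -/

section Transversals
variable {X : Type*} [DecidableEq X] {k : ℕ}

/-- The families of fewer than `k` generators produce few sets, and each of the remaining
generated sets is the union of an ordered `k`-clique of nonempty generators. -/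
theorem card_le_of_kGenerates {G F : Finset (Finset X)} {M : ℕ} (hG : KGenerates k G F)
    (hM : 1 ≤ M) (hGM : #(G.erase ∅) ≤ M) :
    #F ≤ k * M ^ (k - 1) +
      #(F ∩ (cliques Disjoint (G.erase ∅) k).image fun a => univ.biUnion a) := by
  set V := G.erase ∅ with hV
  have hsub : F ⊆ ((range k).biUnion fun j => powersetCard j V).image (fun Q => Q.biUnion id) ∪
      (F ∩ (cliques Disjoint V k).image fun a => univ.biUnion a) := by
    intro x hx
    obtain ⟨P, hPG, hPk, hPd, rfl⟩ := hG x hx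
    have hQ : (P.erase ∅).biUnion id = P.biUnion id := by
      ext z
      simp only [mem_biUnion, mem_erase, id]
      constructor
      · rintro ⟨p, ⟨-, hp⟩, hz⟩; exact ⟨p, hp, hz⟩
      · rintro ⟨p, hp, hz⟩; exact ⟨p, ⟨ne_empty_of_mem hz, hp⟩, hz⟩
    have hQV : P.erase ∅ ⊆ V := erase_subset_erase _ hPG
    rcases (card_le_card (erase_subset ∅ P)).trans hPk |>.lt_or_eq with hlt | heq
    · exact mem_union_left _ (mem_image.2 ⟨P.erase ∅, mem_biUnion.2 ⟨_, mem_range.2 hlt,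
        mem_powersetCard.2 ⟨hQV, rfl⟩⟩, hQ⟩)
    · refine mem_union_right _ (mem_inter.2 ⟨hx, mem_image.2 ?_⟩)
      let e := (P.erase ∅).equivFinOfCardEq heq
      refine ⟨fun i => (e.symm i : Finset X), mem_cliques.2 ⟨fun i => hQV (e.symm i).2,
        fun i j hij => ?_⟩, ?_⟩
      · refine hPd (mem_of_mem_erase (e.symm i).2) (mem_of_mem_erase (e.symm j).2) fun h => hij ?_
        exact e.symm.injective (Subtype.ext h)
      · rw [← hQ]
        ext z
        simp only [mem_biUnion, mem_univ, true_and, id]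
        constructor
        · rintro ⟨i, hi⟩; exact ⟨_, (e.symm i).2, hi⟩
        · rintro ⟨p, hp, hz⟩; exact ⟨e ⟨p, hp⟩, by simpa using hz⟩
  refine (card_le_card hsub).trans ((card_union_le _ _).trans (Nat.add_le_add_right ?_ _))
  refine card_image_le.trans (card_biUnion_le.trans ?_)
  calc ∑ j ∈ range k, #(powersetCard j V) ≤ ∑ _j ∈ range k, M ^ (k - 1) := by
        refine sum_le_sum fun j hj => ?_
        rw [card_powersetCard]
        have := mem_range.1 hj
        exact (Nat.choose_le_pow _ _).trans ((Nat.pow_le_pow_left hGM j).trans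
          (Nat.pow_le_pow_right hM (by omega)))
    _ = _ := by simp

/-- Each union of a `k`-clique of nonempty sets comes from at least `k!` ordered cliques. -/
theorem factorial_mul_card_le_card_cliques {V : Finset (Finset X)} (hV : ∅ ∉ V)
    {A : Finset (Finset X)} (hA : A ⊆ (cliques Disjoint V k).image fun a => univ.biUnion a) :
    k.factorial * #A ≤ #(cliques Disjoint V k) := by
  have h : ∀ x ∈ A, ∃ a ∈ cliques Disjoint V k, univ.biUnion a = x :=
    fun x hx => mem_image.1 (hA hx)
  choose! f hf hfx using h
  have hinj : ∀ a ∈ cliques Disjoint V k, Function.Injective a := by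
    intro a ha i j hij
    rw [mem_cliques] at ha
    by_contra hne
    have h1 := ha.2 i j hne
    rw [hij, disjoint_self] at h1
    exact hV (by simpa [h1] using ha.1 j)
  have hunion : ∀ (a : Fin k → Finset X) (σ : Equiv.Perm (Fin k)),
      univ.biUnion (a ∘ σ) = univ.biUnion a := by
    intro a σ
    ext z
    simp only [mem_biUnion, mem_univ, true_and, Function.comp]
    exact σ.exists_congr_left.trans (by simp)
  have := card_le_card_of_injOn (s := (univ : Finset (Equiv.Perm (Fin k))) ×ˢ A)
    (t := cliques Disjoint V k) (fun p => f p.2 ∘ p.1) ?_ ?_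
  · simpa [Fintype.card_perm] using this
  · rintro ⟨σ, x⟩ hp
    have hx : x ∈ A := (mem_product.1 hp).2
    have := mem_cliques.1 (hf x hx)
    exact mem_cliques.2 ⟨fun i => this.1 _, fun i j hij => this.2 _ _ fun h => hij (σ.injective h)⟩
  · rintro ⟨σ, x⟩ hp ⟨τ, y⟩ hq heq
    have hx : x ∈ A := (mem_product.1 hp).2
    have hy : y ∈ A := (mem_product.1 hq).2
    simp only at heq
    have hxy : x = y := by
      rw [← hfx x hx, ← hfx y hy, ← hunion _ σ, heq, hunion]
    subst hxy
    refine Prod.ext (Equiv.ext fun i => hinj _ (hf x hx) ?_) rfl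
    exact congrFun heq i

/-- A `k`-clique whose entries lie in the union of the `B i`, no two of them in the same `B i`, is
a transversal up to order; the other cliques are counted by the complement of the union and by the
related pairs inside the `B i`. -/
theorem card_sub_card_transversals_mul_le {V : Finset (Finset X)} (B : Fin k → Finset (Finset X))
    {A : Finset (Finset X)} (hBV : ∀ i, B i ⊆ V)
    (hA : A ⊆ (cliques Disjoint V k).image fun a => univ.biUnion a)
    (hBd : Pairwise fun i j => Disjoint (B i) (B j)) :
    ((#A : ℝ) - #(A ∩ (transversals B).image fun a => univ.biUnion a)) * (#V : ℝ) ^ 2 ≤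
      (k : ℝ) ^ 2 * (((#V : ℝ) - ∑ i, (#(B i) : ℝ)) * #V
        + ∑ i, (#(relPairs Disjoint (B i)) : ℝ)) * (#V : ℝ) ^ k := by
  set Ω := Fintype.piFinset fun _ : Fin k => V
  set U := V \ univ.biUnion B with hU
  set bad₁ := (univ : Finset (Fin k)).biUnion fun j => {a ∈ Ω | a j ∈ U}
  set bad₂ := ((univ : Finset (Fin k)).offDiag ×ˢ univ).biUnion fun p : (Fin k × Fin k) × Fin k =>
    {a ∈ Ω | (a p.1.1, a p.1.2) ∈ relPairs Disjoint (B p.2)}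
  have hsub : A ⊆ (A ∩ (transversals B).image fun a => univ.biUnion a) ∪
      (bad₁ ∪ bad₂).image fun a => univ.biUnion a := by
    intro x hx
    obtain ⟨a, ha, rfl⟩ := mem_image.1 (hA hx)
    have ha' := mem_cliques.1 ha
    have haΩ : a ∈ Ω := Fintype.mem_piFinset.2 ha'.1
    by_cases h1 : ∃ j, a j ∈ U
    · obtain ⟨j, hj⟩ := h1
      exact mem_union_right _ (mem_image_of_mem _ (mem_union_left _
        (mem_biUnion.2 ⟨j, mem_univ j, mem_filter.2 ⟨haΩ, hj⟩⟩)))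
    by_cases h2 : ∃ j l i, j ≠ l ∧ a j ∈ B i ∧ a l ∈ B i
    · obtain ⟨j, l, i, hjl, hj, hl⟩ := h2
      refine mem_union_right _ (mem_image_of_mem _ (mem_union_right _
        (mem_biUnion.2 ⟨((j, l), i), by simpa using hjl, mem_filter.2 ⟨haΩ, ?_⟩⟩)))
      exact mem_filter.2 ⟨mem_product.2 ⟨hj, hl⟩, ha'.2 j l hjl⟩
    · push Not at h1 h2
      have h3 : ∀ j, ∃ i, a j ∈ B i := by
        intro j
        have := h1 j
        simp only [hU, mem_sdiff, not_and, not_not] at this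
        simpa using this (ha'.1 j)
      choose f hf using h3
      have hfinj : Function.Injective f := by
        intro j l hjl
        by_contra hne
        exact h2 j l (f j) hne (hf j) (hjl ▸ hf l)
      let σ : Equiv.Perm (Fin k) := Equiv.ofBijective f (Finite.injective_iff_bijective.1 hfinj)
      refine mem_union_left _ (mem_inter.2 ⟨hx, mem_image.2 ⟨a ∘ σ.symm, ?_, ?_⟩⟩)
      · refine mem_filter.2 ⟨Fintype.mem_piFinset.2 fun i => ?_, fun i j hij => ?_⟩
        · have := hf (σ.symm i)
          rwa [show f (σ.symm i) = i from σ.apply_symm_apply i] at this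
        · exact ha'.2 _ _ fun h => hij (σ.symm.injective h)
      · ext z
        simp only [mem_biUnion, mem_univ, true_and, Function.comp]
        exact σ.symm.exists_congr_left.trans (by simp)
  have hcard : (#A : ℝ) - #(A ∩ (transversals B).image fun a => univ.biUnion a) ≤
      #bad₁ + #bad₂ := by
    have := (card_le_card hsub).trans ((card_union_le _ _).trans
      (Nat.add_le_add_left (card_image_le.trans (card_union_le _ _)) _))
    rw [sub_le_iff_le_add']
    exact_mod_cast this
  have hb1 : #bad₁ * #V ≤ k * (#U * #V ^ k) := by
    calc #bad₁ * #V ≤ (∑ j : Fin k, #{a ∈ Ω | a j ∈ U}) * #V :=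
          Nat.mul_le_mul_right _ card_biUnion_le
      _ = ∑ j : Fin k, #U * #V ^ k := by
          rw [sum_mul]
          refine sum_congr rfl fun j _ => ?_
          have := card_piFinset_filter_mem_mul (fun _ : Fin k => V) j U sdiff_subset
          rw [prod_const, card_univ, Fintype.card_fin] at this
          exact this
      _ = _ := by simp
  have hb2 : #bad₂ * (#V * #V) ≤ k ^ 2 * ((∑ i, #(relPairs Disjoint (B i))) * #V ^ k) := by
    calc #bad₂ * (#V * #V) ≤ (∑ p ∈ (univ : Finset (Fin k)).offDiag ×ˢ (univ : Finset (Fin k)),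
            #{a ∈ Ω | (a p.1.1, a p.1.2) ∈ relPairs Disjoint (B p.2)}) * (#V * #V) :=
          Nat.mul_le_mul_right _ card_biUnion_le
      _ = ∑ p ∈ (univ : Finset (Fin k)).offDiag ×ˢ (univ : Finset (Fin k)),
            #(relPairs Disjoint (B p.2)) * #V ^ k := by
          rw [sum_mul]
          refine sum_congr rfl fun p hp => ?_
          have hp' : p.1.1 ≠ p.1.2 := (mem_offDiag.1 (mem_product.1 hp).1).2.2
          have := card_piFinset_filter_pair_mul (fun _ : Fin k => V) hp'
            (relPairs Disjoint (B p.2))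
            ((filter_subset _ _).trans (product_subset_product (hBV _) (hBV _)))
          rw [prod_const, card_univ, Fintype.card_fin] at this
          exact this
      _ = #(univ : Finset (Fin k)).offDiag * ((∑ i, #(relPairs Disjoint (B i))) * #V ^ k) := by
          rw [sum_product]
          simp only [sum_const, smul_eq_mul, sum_mul]
      _ ≤ _ := by
          refine Nat.mul_le_mul_right _ ?_
          rw [offDiag_card, card_univ, Fintype.card_fin, sq]
          exact Nat.sub_le _ _
  have hUc : (#U : ℝ) = #V - ∑ i, (#(B i) : ℝ) := by
    have h1 : #(univ.biUnion B) = ∑ i, #(B i) := card_biUnion fun i _ j _ hij => hBd hij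
    have h2 : #U + #(univ.biUnion B) = #V :=
      card_sdiff_add_card_eq_card (biUnion_subset.2 fun i _ => hBV i)
    rw [h1] at h2
    rw [eq_sub_iff_add_eq]
    exact_mod_cast h2
  have hb1' : (#bad₁ : ℝ) * #V ≤ k * (#U * (#V : ℝ) ^ k) := by exact_mod_cast hb1
  have hb2' : (#bad₂ : ℝ) * (#V * #V) ≤
      (k : ℝ) ^ 2 * ((∑ i, (#(relPairs Disjoint (B i)) : ℝ)) * (#V : ℝ) ^ k) := by
    exact_mod_cast hb2
  have hkk : (k : ℝ) ≤ (k : ℝ) ^ 2 := by exact_mod_cast Nat.le_self_pow (by norm_num) k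
  rw [← hUc]
  have hm : (0 : ℝ) ≤ #V := Nat.cast_nonneg _
  have hu : (0 : ℝ) ≤ #U := Nat.cast_nonneg _
  generalize (#V : ℝ) = m at *
  generalize (#U : ℝ) = u at *
  calc _ ≤ ((#bad₁ : ℝ) + #bad₂) * m ^ 2 := mul_le_mul_of_nonneg_right hcard (by positivity)
    _ = (#bad₁ : ℝ) * m * m + #bad₂ * (m * m) := by ring
    _ ≤ k * (u * m ^ k) * m +
        (k : ℝ) ^ 2 * ((∑ i, (#(relPairs Disjoint (B i)) : ℝ)) * m ^ k) :=
      add_le_add (mul_le_mul_of_nonneg_right hb1' hm) hb2'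
    _ ≤ (k : ℝ) ^ 2 * (u * m ^ k) * m +
        (k : ℝ) ^ 2 * ((∑ i, (#(relPairs Disjoint (B i)) : ℝ)) * m ^ k) := by
      refine add_le_add_left (mul_le_mul_of_nonneg_right
        (mul_le_mul_of_nonneg_right hkk (by positivity)) hm) _
    _ = _ := by ring

end Transversals

/-! ### Real estimates -/

/-- An upper bound for a product by the inequality of arithmetic and geometric means, which is
replaced by the estimate `y ≤ exp (y - 1)` for each factor. -/
theorem prod_le_of_sum_le {k : ℕ} {y : Fin k → ℝ} {θ : ℝ} (hy : ∀ i, 0 ≤ y i) (hθ : 0 ≤ θ)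
    (hkθ : k * θ ≤ 1) (hsum : ∑ i, y i ≤ (1 + θ) * k) : ∏ i, y i ≤ 1 + 2 * k * θ := by
  calc ∏ i, y i ≤ ∏ i, Real.exp (y i - 1) :=
        prod_le_prod (fun i _ => hy i) fun i _ => by linarith [Real.add_one_le_exp (y i - 1)]
    _ = Real.exp (∑ i, y i - k) := by rw [← Real.exp_sum]; simp
    _ ≤ Real.exp (k * θ) := Real.exp_le_exp.2 (by linarith)
    _ ≤ 1 + 2 * k * θ := by
      have h0 : 0 ≤ k * θ := by positivity
      have := Real.exp_bound' h0 hkθ (n := 1) (by norm_num)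
      norm_num at this
      linarith

theorem log_one_sub_ge {γ : ℝ} (hγ0 : 0 ≤ γ) (hγ : γ ≤ 1 / 2) : -(2 * γ) ≤ Real.log (1 - γ) := by
  have h := Real.one_sub_inv_le_log_of_pos (show 0 < 1 - γ by linarith)
  have : (1 - γ)⁻¹ ≤ 1 + 2 * γ := by
    rw [inv_le_iff_one_le_mul₀ (by linarith)]
    nlinarith
  linarith

theorem sum_ge_of_prod_ge {k : ℕ} {y : Fin k → ℝ} {γ : ℝ} (hy : ∀ i, 0 < y i) (hγ0 : 0 ≤ γ)
    (hγ : γ ≤ 1 / 2) (hprod : 1 - γ ≤ ∏ i, y i) : k - 2 * γ ≤ ∑ i, y i := by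
  have h1 : Real.log (1 - γ) ≤ ∑ i, Real.log (y i) := by
    rw [← Real.log_prod fun i _ => (hy i).ne']
    exact Real.log_le_log (by linarith) hprod
  have h2 : ∑ i, Real.log (y i) ≤ ∑ i, (y i - 1) :=
    sum_le_sum fun i _ => Real.log_le_sub_one_of_pos (hy i)
  have := log_one_sub_ge hγ0 hγ
  simp at h2
  linarith

/-- A quantitative form of the equality case of the inequality of arithmetic and geometric means:
if the mean is hardly more than `1` and the product hardly less, no entry is much below `1`. -/
theorem two_thirds_le_of_sum_le {k : ℕ} {y : Fin k → ℝ} {γ θ : ℝ} (hy : ∀ i, 0 < y i)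
    (hγ0 : 0 ≤ γ) (hγ : γ ≤ 1 / 2) (hprod : 1 - γ ≤ ∏ i, y i) (hsum : ∑ i, y i ≤ (1 + θ) * k)
    (hs : k * θ + 2 * γ ≤ 1 / 50) (i : Fin k) : 2 / 3 ≤ y i := by
  have h1 : Real.log (1 - γ) ≤ ∑ i, Real.log (y i) := by
    rw [← Real.log_prod fun i _ => (hy i).ne']
    exact Real.log_le_log (by linarith) hprod
  have h2 : y i - 1 - Real.log (y i) ≤ ∑ i, (y i - 1 - Real.log (y i)) :=
    single_le_sum (f := fun i => y i - 1 - Real.log (y i))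
      (fun j _ => by linarith [Real.log_le_sub_one_of_pos (hy j)]) (mem_univ i)
  have h3 := log_one_sub_ge hγ0 hγ
  simp only [sum_sub_distrib, sum_const, card_univ, Fintype.card_fin, nsmul_eq_mul, mul_one] at h2
  by_contra! hlt
  -- compare `log (y i)` with `log (2 / 3) = log (4 / 3) - log 2`
  have h4 : Real.log (y i) = Real.log (3 / 2 * y i) + Real.log (4 / 3) - Real.log 2 := by
    rw [← Real.log_mul (by have := hy i; positivity) (by norm_num),
      ← Real.log_div (by have := hy i; positivity) (by norm_num)]
    congr 1; ring
  have h5 := Real.log_le_sub_one_of_pos (show 0 < 3 / 2 * y i by have := hy i; positivity)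
  have h6 := Real.log_le_sub_one_of_pos (show (0 : ℝ) < 4 / 3 by norm_num)
  have h7 := Real.log_two_gt_d9
  linarith

/-- Here `h₀` and `h₁` stand for the numbers of `(k - 1)`- and `k`-cliques and `f` for `k!`: if `h₁`
is not much below its value in the balanced complete `k`-partite relation on `m` points, and `h₀`
not much above, then the ratio `h₁ / h₀` is not much below its value `m / k` there. -/
theorem ratio_lower_bound {k r : ℕ} (hkr : k = r + 1) {m a u f h₀ h₁ : ℝ} (hm : 0 < m)
    (hf : 0 < f) (ha0 : 0 ≤ a) (hu0 : 0 ≤ u) (hu1 : u ≤ 1) (ha1 : a ≤ 1) (hh₀ : 0 < h₀)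
    (h1 : f * (1 - a) * (m / k) ^ k ≤ h₁) (h0 : h₀ ≤ (m / k * (1 + u)) ^ r * f) :
    m * (1 - (a + k * u)) ≤ k * (h₁ / h₀) := by
  have hk : (0 : ℝ) < k := by rw [hkr]; positivity
  rcases le_or_gt (1 - (a + k * u)) 0 with hneg | hpos
  · have : 0 ≤ h₁ := le_trans (by have : 0 ≤ 1 - a := by linarith
                                  positivity) h1
    have h2 : 0 ≤ k * (h₁ / h₀) := by positivity
    nlinarith
  rw [← mul_div_assoc, le_div_iff₀ hh₀]
  have hb : 1 - k * u ≤ (1 - u) ^ r := by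
    have := one_add_mul_le_pow (a := -u) (by linarith) r
    have hkr' : (k : ℝ) = r + 1 := by rw [hkr]; push_cast; ring
    rw [hkr', ← sub_eq_add_neg] at *
    nlinarith
  have h3 : (1 - (a + k * u)) * (1 + u) ^ r ≤ 1 - a := by
    calc (1 - (a + k * u)) * (1 + u) ^ r ≤ ((1 - a) * (1 - u) ^ r) * (1 + u) ^ r := by
          gcongr
          have : (1 - a) * (1 - k * u) ≤ (1 - a) * (1 - u) ^ r :=
            mul_le_mul_of_nonneg_left hb (by linarith)
          have : 0 ≤ a * (k * u) := by positivity
          linarith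
      _ = (1 - a) * ((1 - u ^ 2) ^ r) := by rw [mul_assoc, ← mul_pow]; ring_nf
      _ ≤ (1 - a) * 1 := by
          have h5 : 0 ≤ 1 - a := by linarith
          gcongr
          exact pow_le_one₀ (by nlinarith) (by nlinarith)
      _ = _ := mul_one _
  calc m * (1 - (a + k * u)) * h₀ ≤ m * (1 - (a + k * u)) * ((m / k * (1 + u)) ^ r * f) := by
        gcongr
    _ = m * (m / k) ^ r * f * ((1 - (a + k * u)) * (1 + u) ^ r) := by rw [mul_pow]; ring
    _ ≤ m * (m / k) ^ r * f * (1 - a) := by gcongr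
    _ = k * (f * (1 - a) * (m / k) ^ k) := by
        rw [hkr, pow_succ]; field_simp
    _ ≤ k * h₁ := by gcongr

/-! ### Stability of near-extremal clique counts -/

/-- Stability for `k`-cliques: if the number of `k`-cliques is nearly that of the balanced complete
`k`-partite relation on as many points and there are few `(k + 1)`-cliques, then there are disjoint
sets `B i` covering almost all points and containing few related pairs. -/
theorem exists_disjoint_parts {α : Type*} {R : α → α → Prop} [DecidableRel R] {V : Finset α}
    (hR : ∀ x y, R x y → R y x) {k : ℕ} (hk : 1 ≤ k) {a θ : ℝ} (hθ : 0 ≤ θ) (ha0 : 0 ≤ a)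
    (ha : a ≤ 1 / 2) (hu : 2 * k ^ (k + 1) * θ ≤ 1) (hm : 0 < #V)
    (h1 : k.factorial * (1 - a) * ((#V : ℝ) / k) ^ k ≤ #(cliques R V k))
    (h2 : (#(cliques R V (k + 1)) : ℝ) ≤ θ * (#V : ℝ) ^ (k + 1)) :
    ∃ B : Fin k → Finset α, (∀ i, B i ⊆ V) ∧ (Pairwise fun i j => Disjoint (B i) (B j)) ∧
      ((#V : ℝ) - ∑ i, (#(B i) : ℝ)) * #V + ∑ i, (#(relPairs R (B i)) : ℝ) ≤
        (a + (k + 2) * (2 * k ^ (k + 1) * θ)) * (#V : ℝ) ^ 2 := by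
  have hk0 : (0 : ℝ) < k := by exact_mod_cast hk
  have hm0 : (0 : ℝ) < #V := by exact_mod_cast hm
  have hf : (1 : ℝ) ≤ k.factorial := by exact_mod_cast Nat.succ_le_of_lt k.factorial_pos
  have hhalf : 1 / 2 * ((#V : ℝ) / k) ^ k ≤ #(cliques R V k) := by
    refine le_trans ?_ h1
    gcongr
    nlinarith
  have hpk : (0 : ℝ) < #(cliques R V k) := lt_of_lt_of_le (by positivity) hhalf
  have hpos : ∀ r ≤ k, (0 : ℝ) < #(cliques R V r) := by
    intro r hr
    refine Nat.decreasingInduction (motive := fun r _ => (0 : ℝ) < #(cliques R V r)) ?_ hpk hr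
    intro s _ ih
    rcases Nat.eq_zero_or_pos #(cliques R V s) with h | h
    · rw [card_cliques_succ hR, card_eq_zero.1 h] at ih
      simp at ih
    · exact_mod_cast h
  set δ : ℝ := 2 * k ^ k * θ with hδ
  have hδ0 : 0 ≤ δ := by positivity
  have hkδ : k * δ = 2 * k ^ (k + 1) * θ := by rw [hδ, pow_succ]; ring
  have hlast : (#(cliques R V (k + 1)) : ℝ) ≤ #V * δ * #(cliques R V k) := by
    refine h2.trans ?_
    calc θ * (#V : ℝ) ^ (k + 1) = #V * δ * (1 / 2 * ((#V : ℝ) / k) ^ k) := by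
          rw [hδ, div_pow, pow_succ]; field_simp
      _ ≤ _ := by gcongr
  have hmm : ∀ r : ℕ, ((r : ℝ) + 1) * (#(cliques R V (r + 1)) : ℝ) ^ 2 ≤
      #(cliques R V r) * (#V * #(cliques R V (r + 1)) + r * #(cliques R V (r + 2))) := by
    intro r
    exact_mod_cast moon_moser hR r
  obtain ⟨r, rfl⟩ : ∃ r, k = r + 1 := ⟨k - 1, by omega⟩
  have hh0 := le_of_moon_moser (h := fun r => (#(cliques R V r) : ℝ)) (by omega) hm0.le hδ0
    (by simp [card_cliques_zero]) hpos hmm hlast r (by omega)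
  have hdesc : (r + 1).descFactorial r = (r + 1).factorial := by
    have := Nat.factorial_mul_descFactorial (Nat.le_succ r)
    simpa using this
  rw [hdesc, hkδ] at hh0
  have hratio := ratio_lower_bound (k := r + 1) (r := r) rfl (f := (r + 1).factorial) hm0
    (by linarith) ha0 (by positivity) hu (by linarith) (hpos r (by omega)) h1 hh0
  obtain ⟨c, -, hc⟩ := exists_clique_partition hR r (V := V) (by exact_mod_cast hpk)
  refine ⟨soleNonNbrs R V c, fun i => filter_subset _ _, fun i j hij => disjoint_soleNonNbrs c hij,
    hc.trans ?_⟩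
  have hq : (#(cliques R V (r + 2)) : ℝ) / #(cliques R V (r + 1)) ≤ #V * δ := by
    rw [div_le_iff₀ hpk]; exact hlast
  rw [← hkδ] at hratio ⊢
  push_cast at hratio hk0 ⊢
  have e1 := mul_le_mul_of_nonneg_left hratio hm0.le
  have e2 : 2 * ((r : ℝ) + 1) * #V * (#(cliques R V (r + 2)) / #(cliques R V (r + 1))) ≤
      2 * ((r : ℝ) + 1) * #V * (#V * δ) := by gcongr
  nlinarith

section Core
variable {X : Type*} [Fintype X] [DecidableEq X]

/-- Almost every subset of `X` is the union of an ordered `k`-clique of nonempty generators, because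
fewer than `k` generators give at most `O(2 ^ (q * (k - 1)))` sets. -/
theorem card_clique_unions_ge {k q : ℕ} (hk : 1 ≤ k) (hX : Fintype.card X = k * q)
    {G F : Finset (Finset X)} {θ : ℝ} (hθ1 : θ ≤ 1)
    (hθq : 1 ≤ θ * 2 ^ q) (hG : KGenerates k G F)
    (hF : (1 - θ) * 2 ^ Fintype.card X ≤ (#F : ℝ))
    (hm : (#(G.erase ∅) : ℝ) ≤ (1 + θ) * (k * 2 ^ q)) :
    (1 - (1 + k * (2 * k) ^ k) * θ) * 2 ^ Fintype.card X ≤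
      (#(F ∩ (cliques Disjoint (G.erase ∅) k).image fun a => univ.biUnion a) : ℝ) := by
  have hk0 : (0 : ℝ) < k := by exact_mod_cast hk
  have hk1 : (1 : ℝ) ≤ k := by exact_mod_cast hk
  have hq : (0 : ℝ) < 2 ^ q := by positivity
  have hM : #(G.erase ∅) ≤ 2 * k * 2 ^ q := by
    have : (#(G.erase ∅) : ℝ) ≤ 2 * k * 2 ^ q := by
      refine hm.trans ?_
      rw [mul_assoc]
      gcongr
      linarith
    exact_mod_cast this
  have h1 : (#F : ℝ) ≤ k * (2 * k * 2 ^ q) ^ (k - 1) +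
      (#(F ∩ (cliques Disjoint (G.erase ∅) k).image fun a => univ.biUnion a) : ℝ) := by
    exact_mod_cast card_le_of_kGenerates hG (Nat.mul_pos (by omega) (by positivity)) hM
  have h2 : (k : ℝ) * (2 * k * 2 ^ q) ^ (k - 1) ≤ k * (2 * k) ^ k * θ * 2 ^ Fintype.card X := by
    have hN : (2 : ℝ) ^ Fintype.card X = (2 ^ q) ^ (k - 1) * 2 ^ q := by
      rw [hX, ← pow_succ, Nat.sub_add_cancel hk, ← pow_mul, mul_comm k]
    calc (k : ℝ) * (2 * k * 2 ^ q) ^ (k - 1) = k * ((2 * k) ^ (k - 1) * (2 ^ q) ^ (k - 1) * 1) := by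
          rw [mul_pow, mul_one]
      _ ≤ k * ((2 * k) ^ k * (2 ^ q) ^ (k - 1) * (θ * 2 ^ q)) := by
          gcongr
          · linarith
          · omega
      _ = _ := by rw [hN]; ring
  linarith

/-- If the disjoint unions of transversals of `B` are almost all subsets of `X`, and the `B i` have
hardly more than `2 ^ q` members on average, then there is a partition into sets of exactly `q`
elements such that almost all members of `B i` lie in the `i`-th class. -/
theorem exists_equal_partition_of_transversals {k q : ℕ} (hk : 1 ≤ k)
    (hX : Fintype.card X = k * q) (B : Fin k → Finset (Finset X)) {F' : Finset (Finset X)}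
    {γ θ : ℝ} (hθ : 0 ≤ θ) (hkγ : 2 * k * θ ≤ γ) (hγ : 200 * (k ^ 2 * γ) ≤ 1)
    (hF' : (1 - γ) * (2 ^ q) ^ k ≤ (#F' : ℝ))
    (hF'B : F' ⊆ (transversals B).image fun a => univ.biUnion a)
    (hm : ∑ i, (#(B i) : ℝ) ≤ (1 + θ) * (k * 2 ^ q)) :
    ∃ S : Fin k → Finset X, Pairwise (fun i j => Disjoint (S i) (S j)) ∧
      univ.biUnion S = univ ∧ (∀ i, #(S i) = q) ∧
      (1 - (16 * k ^ 2 + 2) * γ) * (k * 2 ^ q) ≤ ∑ i, (#{b ∈ B i | b ⊆ S i} : ℝ) := by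
  have hk1 : (1 : ℝ) ≤ k := by exact_mod_cast hk
  have hkk : (1 : ℝ) ≤ k ^ 2 := one_le_pow₀ hk1
  have hγ0 : 0 ≤ γ := le_trans (by positivity) hkγ
  have hγ' : 200 * γ ≤ 1 := by nlinarith
  have hN : (2 : ℝ) ^ Fintype.card X = (2 ^ q) ^ k := by rw [hX, ← pow_mul, mul_comm k]
  obtain ⟨N, hNdef⟩ : ∃ N : ℝ, N = 2 ^ q := ⟨_, rfl⟩
  rw [← hNdef] at hm hF' ⊢
  have hN0 : 0 < N := by rw [hNdef]; positivity
  -- the normalised sizes of the parts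
  have hbsum : ∑ i, (#(B i) : ℝ) / N ≤ (1 + θ) * k := by
    rw [← sum_div, div_le_iff₀ hN0]
    exact hm.trans_eq (by ring)
  have hprodN : ∏ i, (#(B i) : ℝ) / N = (∏ i, (#(B i) : ℝ)) / N ^ k := by
    rw [prod_div_distrib]; simp
  have hprod_le : ∏ i, (#(B i) : ℝ) ≤ (1 + γ) * N ^ k := by
    have := prod_le_of_sum_le (y := fun i => (#(B i) : ℝ) / N)
      (fun i => div_nonneg (Nat.cast_nonneg _) hN0.le) hθ (by linarith) hbsum
    rw [hprodN, div_le_iff₀ (by positivity)] at this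
    refine this.trans ?_
    gcongr
  have hprod_ge : (1 - γ) * N ^ k ≤ ∏ i, (#(B i) : ℝ) := by
    refine hF'.trans ?_
    have : #F' ≤ ∏ i, #(B i) := (card_le_card hF'B).trans (card_image_le.trans
      ((card_filter_le _ _).trans_eq (Fintype.card_piFinset _)))
    exact_mod_cast this
  have hprod1 : 1 - γ ≤ ∏ i, (#(B i) : ℝ) / N := by
    rw [hprodN, le_div_iff₀ (by positivity)]; exact hprod_ge
  have hbpos : ∀ i, 0 < (#(B i) : ℝ) / N := by
    intro i
    have h0 : 0 < ∏ i, (#(B i) : ℝ) / N := by linarith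
    have := prod_ne_zero_iff.1 h0.ne' i (mem_univ i)
    exact lt_of_le_of_ne (div_nonneg (Nat.cast_nonneg _) hN0.le) this.symm
  have hbig := two_thirds_le_of_sum_le hbpos hγ0 (by linarith) hprod1 hbsum (by linarith)
  have hsum_ge := sum_ge_of_prod_ge hbpos hγ0 (by linarith) hprod1
  obtain ⟨S, hSd, hSu, hS⟩ := exists_partition_of_transversals B hγ0 (by linarith)
    (by rw [hN, ← hNdef]; exact hF') (by rw [hN, ← hNdef]; exact hprod_le) hF'B
  have hgood : ∀ i, (1 - 16 * k ^ 2 * γ) * ((#(B i) : ℝ) / N) * N ≤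
      #{b ∈ B i | b ⊆ S i} := by
    intro i
    rw [mul_assoc, div_mul_cancel₀ _ hN0.ne']
    exact hS i
  have hcoef : 0 ≤ 1 - 16 * k ^ 2 * γ := by linarith
  -- more than half of `2 ^ q` sets fit into each class, so each class has at least `q` elements
  have hSq : ∀ i, q ≤ #(S i) := by
    intro i
    by_contra! hlt
    have h1 : (#{b ∈ B i | b ⊆ S i} : ℝ) ≤ 2 ^ #(S i) := by
      have : #{b ∈ B i | b ⊆ S i} ≤ #(S i).powerset :=
        card_le_card fun b hb => mem_powerset.2 (mem_filter.1 hb).2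
      rw [card_powerset] at this
      exact_mod_cast this
    have h2 : (2 : ℝ) ^ #(S i) * 2 ≤ N := by
      rw [hNdef, ← pow_succ]
      exact pow_le_pow_right₀ (by norm_num) hlt
    have h3 : (7 / 8 : ℝ) * (2 / 3) * N ≤
        (1 - 16 * k ^ 2 * γ) * ((#(B i) : ℝ) / N) * N :=
      mul_le_mul_of_nonneg_right (mul_le_mul (by linarith) (hbig i) (by norm_num) hcoef) hN0.le
    linarith [hgood i]
  have hSsum : ∑ i, #(S i) = k * q := by
    rw [← card_biUnion fun i _ j _ hij => hSd hij, hSu, card_univ, hX]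
  have hSeq : ∀ i, #(S i) = q := by
    have := (sum_eq_sum_iff_of_le fun i (_ : i ∈ (univ : Finset (Fin k))) => hSq i).1
      (by rw [hSsum]; simp)
    exact fun i => (this i (mem_univ i)).symm
  refine ⟨S, hSd, hSu, hSeq, ?_⟩
  calc (1 - (16 * k ^ 2 + 2) * γ) * (k * N)
      ≤ (1 - 16 * k ^ 2 * γ) * (k - 2 * γ) * N := by
        rw [← mul_assoc]
        refine mul_le_mul_of_nonneg_right ?_ hN0.le
        have h1 : 0 ≤ 16 * k ^ 2 * γ * (2 * γ) := by positivity
        have h2 : 1 * γ ≤ k * γ := by gcongr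
        linarith
    _ ≤ (1 - 16 * k ^ 2 * γ) * (∑ i, (#(B i) : ℝ) / N) * N := by gcongr
    _ = ∑ i, (1 - 16 * k ^ 2 * γ) * ((#(B i) : ℝ) / N) * N := by
        rw [mul_sum, sum_mul]
    _ ≤ ∑ i, (#{b ∈ B i | b ⊆ S i} : ℝ) := sum_le_sum fun i _ => hgood i

/-- The statement in terms of a single small parameter `θ`, which bounds the proportion of missing
sets, the relative excess of the generator, `2 ^ (-q)`, and the density of `(k + 1)`-cliques. -/
theorem exists_equal_partition (k : ℕ) (hk : 1 ≤ k) :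
    ∃ C θ₀ : ℝ, 0 < C ∧ 0 < θ₀ ∧ ∀ (X : Type*) [Fintype X] [DecidableEq X] (q : ℕ),
      Fintype.card X = k * q → ∀ (G F : Finset (Finset X)) (θ : ℝ), 0 ≤ θ → θ ≤ θ₀ →
      1 ≤ θ * 2 ^ q → KGenerates k G F → (1 - θ) * 2 ^ Fintype.card X ≤ (#F : ℝ) →
      (#(G.erase ∅) : ℝ) ≤ (1 + θ) * (k * 2 ^ q) →
      ((2 : ℝ) ^ q ≤ 2 * #(G.erase ∅) → (#(cliques Disjoint (G.erase ∅) (k + 1)) : ℝ) ≤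
        θ * (#(G.erase ∅) : ℝ) ^ (k + 1)) →
      ∃ S : Fin k → Finset X, Pairwise (fun i j => Disjoint (S i) (S j)) ∧
        univ.biUnion S = univ ∧ (∀ i, #(S i) = q) ∧
        (1 - C * θ) * (k * 2 ^ q) ≤ ∑ i, (#{v ∈ G.erase ∅ | v ⊆ S i} : ℝ) := by
  have hk0 : (0 : ℝ) < k := by exact_mod_cast hk
  have hk1 : (1 : ℝ) ≤ k := by exact_mod_cast hk
  obtain ⟨C₁, hC₁⟩ : ∃ C₁ : ℝ, C₁ = 1 + k * (2 * k) ^ k := ⟨_, rfl⟩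
  obtain ⟨D, hD⟩ : ∃ D : ℝ, D = 2 * k ^ (k + 1) := ⟨_, rfl⟩
  obtain ⟨C₄, hC₄⟩ : ∃ C₄ : ℝ, C₄ = (C₁ + k) + (k + 2) * D := ⟨_, rfl⟩
  obtain ⟨C₅, hC₅⟩ : ∃ C₅ : ℝ, C₅ = C₁ + k ^ 2 * C₄ * (2 * k) ^ k + 2 * k + D := ⟨_, rfl⟩
  have hC₁1 : 1 ≤ C₁ := by rw [hC₁]; exact le_add_of_nonneg_right (by positivity)
  have hC₁0 : 0 < C₁ := by linarith
  have hD0 : 0 < D := by rw [hD]; positivity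
  have hC₄0 : 0 < C₄ := by rw [hC₄]; positivity
  have hE0 : 0 ≤ k ^ 2 * C₄ * (2 * (k : ℝ)) ^ k := by positivity
  have hC₅0 : 0 < C₅ := by rw [hC₅]; positivity
  refine ⟨(16 * k ^ 2 + 2) * C₅, 1 / (200 * k ^ 2 * C₅), by positivity, by positivity, ?_⟩
  intro X _ _ q hX G F θ hθ hθ₀ hθq hG hF hm hcl
  -- numerical consequences of the choice of `θ₀`
  have hγ : 200 * (k ^ 2 * (C₅ * θ)) ≤ 1 := by
    rw [le_div_iff₀ (by positivity)] at hθ₀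
    linarith
  have hkk : (1 : ℝ) ≤ k ^ 2 := one_le_pow₀ hk1
  have hγ0 : 0 ≤ C₅ * θ := by positivity
  have hγ' : 200 * (C₅ * θ) ≤ 1 := by nlinarith
  have hC₁C₅ : (C₁ + k) * θ ≤ C₅ * θ := by gcongr; linarith
  have hDC₅ : D * θ ≤ C₅ * θ := by gcongr; linarith
  have hkC₅ : 2 * k * θ ≤ C₅ * θ := by gcongr; linarith
  have hC₁θ : C₁ * θ ≤ C₅ * θ := by gcongr; linarith
  have hθ1 : θ ≤ 1 := by
    have : 1 * θ ≤ C₁ * θ := by gcongr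
    linarith
  obtain ⟨V, hV⟩ : ∃ V, V = G.erase ∅ := ⟨_, rfl⟩
  have hVe : ∅ ∉ V := by rw [hV]; simp
  have hcount := card_clique_unions_ge hk hX hθ1 hθq hG hF hm
  rw [← hV] at hm hcl hcount ⊢
  rw [← hC₁] at hcount
  obtain ⟨A, hA⟩ : ∃ A, A = F ∩ (cliques Disjoint V k).image fun a => univ.biUnion a := ⟨_, rfl⟩
  have hAsub : A ⊆ (cliques Disjoint V k).image fun a => univ.biUnion a := by
    rw [hA]; exact inter_subset_right
  rw [← hA] at hcount
  have hfact : (k.factorial : ℝ) * #A ≤ #(cliques Disjoint V k) := by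
    exact_mod_cast factorial_mul_card_le_card_cliques hVe hAsub
  have hN : (2 : ℝ) ^ Fintype.card X = (2 ^ q) ^ k := by rw [hX, ← pow_mul, mul_comm k]
  rw [hN] at hcount
  obtain ⟨N, hNdef⟩ : ∃ N : ℝ, N = 2 ^ q := ⟨_, rfl⟩
  rw [← hNdef] at hm hcl hcount hθq ⊢
  have hN0 : 0 < N := by rw [hNdef]; positivity
  have hf : (1 : ℝ) ≤ k.factorial := by exact_mod_cast Nat.succ_le_of_lt k.factorial_pos
  have hclm : (#(cliques Disjoint V k) : ℝ) ≤ (#V : ℝ) ^ k := by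
    exact_mod_cast card_cliques_le (R := Disjoint) (V := V) k
  have hNV : N ≤ 2 * #V := by
    have h1 : (N / 2) ^ k ≤ (#V : ℝ) ^ k := by
      calc (N / 2) ^ k = (1 / 2) ^ k * N ^ k := by rw [← mul_pow]; ring
        _ ≤ (1 / 2) * N ^ k := by
          gcongr
          exact pow_le_of_le_one (by norm_num) (by norm_num) (by omega)
        _ ≤ (1 - C₁ * θ) * N ^ k := by gcongr; linarith
        _ ≤ #A := hcount
        _ ≤ k.factorial * #A := le_mul_of_one_le_left (Nat.cast_nonneg _) hf
        _ ≤ _ := hfact.trans hclm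
    have := le_of_pow_le_pow_left₀ (by omega) (Nat.cast_nonneg _) h1
    linarith
  have hm0 : (0 : ℝ) < #V := by linarith
  -- compare `N` with `#V / k`
  have hVN : ((#V : ℝ) / k) ^ k * (1 - k * θ) ≤ N ^ k := by
    have h1 : (#V : ℝ) / k * (1 - θ) ≤ N := by
      rw [div_mul_eq_mul_div, div_le_iff₀ hk0]
      have : (#V : ℝ) * (1 - θ) ≤ (1 + θ) * (k * N) * (1 - θ) :=
        mul_le_mul_of_nonneg_right hm (by linarith)
      have : 0 ≤ k * N * θ ^ 2 := by positivity
      linarith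
    have h2 := one_add_mul_le_pow (a := -θ) (by linarith) k
    have h3 : 0 ≤ 1 - θ := by linarith
    calc ((#V : ℝ) / k) ^ k * (1 - k * θ) ≤ ((#V : ℝ) / k) ^ k * (1 - θ) ^ k := by
          gcongr
          rw [← sub_eq_add_neg] at h2
          linarith
      _ = ((#V : ℝ) / k * (1 - θ)) ^ k := by rw [mul_pow]
      _ ≤ N ^ k := by gcongr
  have hcl1 : k.factorial * (1 - (C₁ + k) * θ) * ((#V : ℝ) / k) ^ k ≤
      #(cliques Disjoint V k) := by
    refine le_trans ?_ hfact
    rw [mul_assoc]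
    gcongr
    refine le_trans ?_ hcount
    have h0 : 0 ≤ 1 - C₁ * θ := by linarith
    have h1 := mul_le_mul_of_nonneg_left hVN h0
    have h2 : 0 ≤ C₁ * θ * (k * θ) * ((#V : ℝ) / k) ^ k := by positivity
    linarith
  obtain ⟨B, hBV, hBd, hBc⟩ := exists_disjoint_parts (R := Disjoint) (V := V)
    (fun _ _ h => h.symm) hk hθ (a := (C₁ + k) * θ) (by positivity) (by linarith)
    (by rw [← hD]; linarith) (by exact_mod_cast hm0) hcl1 (hcl hNV)
  obtain ⟨F', hF'⟩ : ∃ F', F' = A ∩ (transversals B).image fun a => univ.biUnion a := ⟨_, rfl⟩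
  have hF'B : F' ⊆ (transversals B).image fun a => univ.biUnion a := by
    rw [hF']; exact inter_subset_right
  have hloss := card_sub_card_transversals_mul_le B hBV hAsub hBd
  rw [← hF'] at hloss
  rw [← hD] at hBc
  have hVk : (#V : ℝ) ^ k ≤ (2 * k) ^ k * N ^ k := by
    rw [← mul_pow]
    gcongr
    refine hm.trans ?_
    rw [mul_assoc]
    gcongr
    linarith
  have hF'1 : (1 - C₅ * θ) * N ^ k ≤ #F' := by
    have h1 : ((#A : ℝ) - #F') * (#V : ℝ) ^ 2 ≤
        (k ^ 2 * (C₄ * θ) * ((2 * k) ^ k * N ^ k)) * (#V : ℝ) ^ 2 := by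
      refine hloss.trans ?_
      calc _ ≤ (k : ℝ) ^ 2 * (((C₁ + k) * θ + (k + 2) * (D * θ)) * (#V : ℝ) ^ 2) *
            ((2 * k) ^ k * N ^ k) := by gcongr
        _ = _ := by rw [hC₄]; ring
    have h2 := le_of_mul_le_mul_right h1 (by positivity)
    have h3 : 0 ≤ (2 * k + D) * θ * N ^ k := by positivity
    have h4 : C₅ * θ * N ^ k = C₁ * θ * N ^ k + k ^ 2 * (C₄ * θ) * ((2 * k) ^ k * N ^ k) +
        (2 * k + D) * θ * N ^ k := by rw [hC₅]; ring
    linarith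
  have hBm : ∑ i, (#(B i) : ℝ) ≤ #V := by
    have h1 : #(univ.biUnion B) = ∑ i, #(B i) := card_biUnion fun i _ j _ hij => hBd hij
    have h2 := card_le_card (biUnion_subset.2 fun i (_ : i ∈ univ) => hBV i)
    rw [h1] at h2
    exact_mod_cast h2
  obtain ⟨S, hSd, hSu, hSq, hS⟩ := exists_equal_partition_of_transversals hk hX B hθ hkC₅ hγ
    (by rw [← hNdef]; exact hF'1) hF'B (by rw [← hNdef]; exact hBm.trans hm)
  refine ⟨S, hSd, hSu, hSq, ?_⟩
  rw [mul_assoc _ C₅, hNdef]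
  exact hS.trans (sum_le_sum fun i _ => Nat.cast_le.2 (card_le_card
    (filter_subset_filter _ (hBV i))))

end Core

/-! ### Small ground sets, and the final choice of constants -/

/-- If every set is generated, the generator contains all singletons. -/
theorem one_le_card_inter_classSubsets {X : Type*} [Fintype X] [DecidableEq X] [Nonempty X] {k : ℕ}
    {V : Fin k → Finset X} (hV : IsEquipartition V) {G : Finset (Finset X)}
    (hG : KGenerates k G univ) : 1 ≤ #(G ∩ classSubsets V) := by
  obtain ⟨x⟩ := ‹Nonempty X›
  obtain ⟨i, -, hi⟩ := mem_biUnion.1 (hV.2.1 ▸ mem_univ x : x ∈ univ.biUnion V)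
  obtain ⟨P, hPG, -, -, hP⟩ := hG {x} (mem_univ _)
  obtain ⟨p, hp, hxp⟩ := mem_biUnion.1 (hP ▸ mem_singleton_self x : x ∈ P.biUnion id)
  have hpx : p ⊆ {x} := by
    rw [← hP]; exact subset_biUnion_of_mem id hp
  have hps : p = {x} := subset_antisymm hpx (singleton_subset_iff.2 hxp)
  refine card_pos.2 ⟨p, mem_inter.2 ⟨hPG hp, mem_biUnion.2 ⟨i, mem_univ i, ?_⟩⟩⟩
  rw [hps, mem_powerset, singleton_subset_iff]
  exact hi

theorem sum_card_subset_le_card_inter_classSubsets {X : Type*} [DecidableEq X] {k : ℕ}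
    (G : Finset (Finset X)) {S : Fin k → Finset X}
    (hS : Pairwise fun i j => Disjoint (S i) (S j)) :
    ∑ i, #{v ∈ G.erase ∅ | v ⊆ S i} ≤ #(G ∩ classSubsets S) := by
  rw [← card_biUnion]
  · refine card_le_card fun v hv => ?_
    obtain ⟨i, -, hi⟩ := mem_biUnion.1 hv
    rw [mem_filter, mem_erase] at hi
    exact mem_inter.2 ⟨hi.1.2, mem_biUnion.2 ⟨i, mem_univ i, mem_powerset.2 hi.2⟩⟩
  · intro i _ j _ hij
    rw [Function.onFun, disjoint_left]
    intro v hv hv'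
    rw [mem_filter, mem_erase] at hv hv'
    exact hv.1.1 (subset_empty.1 ((hS hij) hv.2 hv'.2))

theorem isEquipartition_of_card_eq {X : Type*} [Fintype X] [DecidableEq X] {k q : ℕ}
    {S : Fin k → Finset X} (hd : Pairwise fun i j => Disjoint (S i) (S j))
    (hu : univ.biUnion S = univ) (hS : ∀ i, #(S i) = q) : IsEquipartition S := by
  refine ⟨hd, hu, fun i j _ _ => ?_⟩
  simp [hS]

/-- If `C * ε ^ (1 / k) < 1` with `1 ≤ C`, then `ε < 1`, so that a bound linear in `ε` is stronger than
one in terms of `ε ^ (1 / k)`. -/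
theorem lt_one_and_le_rpow {C ε : ℝ} {k : ℕ} (hk : 1 ≤ k) (hC : 1 ≤ C) (hε : 0 ≤ ε)
    (h : C * ε ^ (1 / (k : ℝ)) < 1) : C * ε < 1 ∧ ε ≤ ε ^ (1 / (k : ℝ)) := by
  have hk1 : (1 : ℝ) ≤ k := by exact_mod_cast hk
  have hε1 : ε ≤ 1 := by
    by_contra! hcon
    have := Real.one_le_rpow hcon.le (show 0 ≤ 1 / (k : ℝ) by positivity)
    nlinarith
  have h1 : ε ≤ ε ^ (1 / (k : ℝ)) :=
    Real.self_le_rpow_of_le_one hε hε1 ((div_le_one (by linarith)).2 hk1)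
  exact ⟨lt_of_le_of_lt (mul_le_mul_of_nonneg_left h1 (by linarith)) h, h1⟩

/-- The conclusion with an error linear in `ε` and `η`, as long as these are small. -/
theorem exists_isEquipartition_linear (k : ℕ) (hk : 1 ≤ k) :
    ∃ C K ξ θ₀ : ℝ, 0 < C ∧ 0 < K ∧ 0 < ξ ∧ 0 < θ₀ ∧
      ∀ (X : Type*) [Fintype X] [DecidableEq X] (q : ℕ), Fintype.card X = k * q →
      ∀ (G F : Finset (Finset X)) (ε η : ℝ), 0 ≤ ε → 0 ≤ η →
      ε + η + K * (2 : ℝ) ^ (-(ξ * (Fintype.card X : ℝ))) ≤ θ₀ →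
      (#G : ℝ) ≤ (1 + η) * (k * 2 ^ q) → KGenerates k G F →
      (1 - ε) * 2 ^ Fintype.card X ≤ (#F : ℝ) →
      ∃ S : Fin k → Finset X, IsEquipartition S ∧
        (1 - C * (ε + η + K * (2 : ℝ) ^ (-(ξ * (Fintype.card X : ℝ))))) * (k * 2 ^ q) ≤
          (#(G ∩ classSubsets S) : ℝ) := by
  obtain ⟨K, ξ, hK, hξ, hcl⟩ := exists_card_cliques_le k hk
  obtain ⟨C, θ₀, hC, hθ₀, hmain⟩ := exists_equal_partition k hk
  have hk0 : (0 : ℝ) < k := by exact_mod_cast hk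
  refine ⟨C, K + 1, min ξ (1 / k), θ₀, hC, by positivity, by positivity, hθ₀, ?_⟩
  intro X _ _ q hX G F ε η hε hη hθ hm hG hF
  set n := Fintype.card X with hn
  set e : ℝ := (2 : ℝ) ^ (-(min ξ (1 / k) * (n : ℝ))) with he
  have he0 : 0 < e := by positivity
  have he1 : (2 : ℝ) ^ (-(ξ * (n : ℝ))) ≤ e := by
    refine Real.rpow_le_rpow_of_exponent_le (by norm_num) (neg_le_neg ?_)
    gcongr
    exact min_le_left _ _
  have he2 : 1 ≤ e * 2 ^ q := by
    rw [he, ← Real.rpow_natCast, ← Real.rpow_add (by norm_num)]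
    refine Real.one_le_rpow (by norm_num) ?_
    have : min ξ (1 / (k : ℝ)) * n ≤ 1 / k * n := by
      gcongr
      exact min_le_right _ _
    have hnq : 1 / (k : ℝ) * n = q := by rw [hX]; push_cast; field_simp
    linarith
  have hKe : K * e ≤ ε + η + (K + 1) * e := by linarith
  have h2q : (0 : ℝ) < 2 ^ q := by positivity
  have h2n : (0 : ℝ) < 2 ^ n := by positivity
  have hcard : (#(G.erase ∅) : ℝ) ≤ #G := Nat.cast_le.2 (card_le_card (erase_subset _ _))
  obtain ⟨S, hSd, hSu, hSq, hS⟩ := hmain X q hX G F (ε + η + (K + 1) * e) (by positivity) hθ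
    (he2.trans (by gcongr; nlinarith)) hG
    (le_trans (by gcongr; nlinarith) hF)
    (hcard.trans (hm.trans (by gcongr; nlinarith)))
    (fun h => (hcl X q hX _ h).trans (by
      gcongr
      exact (mul_le_mul_of_nonneg_left he1 hK.le).trans hKe))
  refine ⟨S, isEquipartition_of_card_eq hSd hSu hSq, hS.trans ?_⟩
  exact_mod_cast sum_card_subset_le_card_inter_classSubsets G hSd

end DisjointGen

theorem mainTheorem3 (k : ℕ) (hk : 1 ≤ k) :
    ∃ C D ξ : ℝ, 0 < C ∧ 0 < D ∧ 0 < ξ ∧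
      ∀ (X : Type*) [Fintype X] [DecidableEq X], k ∣ Fintype.card X →
      ∀ V : Fin k → Finset X, DisjointGen.IsEquipartition V →
      ∀ ε η : ℝ, 0 ≤ ε → 0 ≤ η →
      ∀ G F : Finset (Finset X),
        (G.card : ℝ) ≤ (1 + η) * ((DisjointGen.canonicalGenerator V).card : ℝ) →
        DisjointGen.KGenerates k G F →
        (1 - ε) * (2 : ℝ) ^ Fintype.card X ≤ (F.card : ℝ) →
        ∃ S : Fin k → Finset X, DisjointGen.IsEquipartition S ∧
          (1 - C * ε ^ (1 / (k : ℝ)) - D * η ^ (1 / (k : ℝ))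
              - (2 : ℝ) ^ (-(ξ * (Fintype.card X : ℝ))))
            * ((DisjointGen.canonicalGenerator V).card : ℝ)
          ≤ ((G ∩ DisjointGen.classSubsets S).card : ℝ) := by
  have hk0 : (0 : ℝ) < k := by exact_mod_cast hk
  obtain ⟨C, K, ξ, θ₀, hC, hK, hξ, hθ₀, hmain⟩ := DisjointGen.exists_isEquipartition_linear k hk
  -- beyond `n₀` half of the exponent `ξ` absorbs the constants
  obtain ⟨n₀, hn₀⟩ := pow_unbounded_of_one_lt (C * K + 3 * K / θ₀)
    (Real.one_lt_rpow (show (1 : ℝ) < 2 by norm_num) (show 0 < ξ / 2 by positivity))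
  -- for `n < n₀` a value of `ε` that lets a set be missing makes the bound trivial: `2 ^ n₀ ≤ C'`
  set C' : ℝ := C + 3 / θ₀ + 2 ^ n₀ + 1 with hC'
  have hC'1 : 1 ≤ C' := le_add_of_nonneg_left (by positivity)
  have hC'C : C ≤ C' := by
    have : 0 ≤ 3 / θ₀ + 2 ^ n₀ + 1 := by positivity
    linarith
  have hC'θ : 3 / θ₀ ≤ C' := by
    have : 0 ≤ C + 2 ^ n₀ + 1 := by positivity
    linarith
  have hC'n : 2 ^ n₀ ≤ C' := by
    have : 0 ≤ C + 3 / θ₀ + 1 := by positivity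
    linarith
  set ξ' : ℝ := min (ξ / 2) (1 / ((n₀ + 1) * (k * 2 ^ n₀))) with hξ'
  have hξ'0 : 0 < ξ' := by positivity
  refine ⟨C', C', ξ', by linarith, by linarith, hξ'0, ?_⟩
  intro X _ _ hdvd V hV ε η hε hη G F hG hgen hF
  obtain ⟨q, hq⟩ := id hdvd
  have hcan : (DisjointGen.canonicalGenerator V).card = k * (2 ^ q - 1) := by
    rw [DisjointGen.card_canonicalGenerator hdvd hV, hq, Nat.mul_div_cancel_left _ (by omega)]
  have hcan' : ((DisjointGen.canonicalGenerator V).card : ℝ) ≤ k * 2 ^ q := by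
    have : (DisjointGen.canonicalGenerator V).card ≤ k * 2 ^ q := by
      rw [hcan]; exact Nat.mul_le_mul_left _ (Nat.sub_le _ _)
    exact_mod_cast this
  set M : ℝ := ((DisjointGen.canonicalGenerator V).card : ℝ) with hM
  have hM0 : 0 ≤ M := Nat.cast_nonneg _
  set n := Fintype.card X with hn
  set A : ℝ := 1 - C' * ε ^ (1 / (k : ℝ)) - C' * η ^ (1 / (k : ℝ)) -
    (2 : ℝ) ^ (-(ξ' * (n : ℝ))) with hA
  have hCε : 0 ≤ C' * ε ^ (1 / (k : ℝ)) := by positivity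
  have hCη : 0 ≤ C' * η ^ (1 / (k : ℝ)) := by positivity
  have h2ξ : 0 < (2 : ℝ) ^ (-(ξ' * (n : ℝ))) := by positivity
  rcases le_or_gt A 0 with hA0 | hA0
  · exact ⟨V, hV, (mul_nonpos_of_nonpos_of_nonneg hA0 hM0).trans (Nat.cast_nonneg _)⟩
  obtain ⟨hε1, hε2⟩ := DisjointGen.lt_one_and_le_rpow hk hC'1 hε (by linarith)
  obtain ⟨hη1, hη2⟩ := DisjointGen.lt_one_and_le_rpow hk hC'1 hη (by linarith)
  rcases lt_or_ge n n₀ with hlt | hge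
  · refine ⟨V, hV, ?_⟩
    rcases isEmpty_or_nonempty X with hX | hX
    · have : q = 0 := by
        have h0 : n = 0 := by rw [hn]; exact Fintype.card_eq_zero
        rw [h0] at hq
        rcases Nat.mul_eq_zero.1 hq.symm with h | h
        · omega
        · exact h
      have hM' : M = 0 := by rw [hM, hcan, this]; simp
      rw [hM', mul_zero]
      exact Nat.cast_nonneg _
    · have hFuniv : F = Finset.univ := by
        refine Finset.eq_univ_of_card F (le_antisymm (Finset.card_le_univ F) ?_)
        rw [Fintype.card_finset, ← hn]
        have h1 : ε * 2 ^ n < 1 := by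
          refine lt_of_le_of_lt ?_ hε1
          rw [mul_comm]
          gcongr
          exact (pow_le_pow_right₀ (by norm_num) hlt.le).trans hC'n
        have h2 : (2 : ℝ) ^ n < F.card + 1 := by linarith
        exact Nat.lt_succ_iff.1 (by exact_mod_cast h2)
      have hone : (1 : ℝ) ≤ ((G ∩ DisjointGen.classSubsets V).card : ℝ) := by
        exact_mod_cast DisjointGen.one_le_card_inter_classSubsets hV (hFuniv ▸ hgen)
      refine le_trans ?_ hone
      have hn' : (n : ℝ) ≤ n₀ := by exact_mod_cast hlt.le
      have h1 : 1 - ξ' * n ≤ (2 : ℝ) ^ (-(ξ' * (n : ℝ))) := by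
        have h2 : 1 - ξ' * n ≤ Real.exp (-(ξ' * n)) := by
          have := Real.add_one_le_exp (-(ξ' * n))
          linarith
        refine h2.trans ?_
        rw [Real.rpow_def_of_pos (by norm_num)]
        refine Real.exp_le_exp.2 ?_
        have h3 : Real.log 2 ≤ 1 := by linarith [Real.log_two_lt_d9]
        have h4 : 0 ≤ ξ' * n := by positivity
        nlinarith
      have hA1 : A ≤ 1 / ((n₀ + 1) * (k * 2 ^ n₀)) * (n₀ + 1) := by
        have : ξ' * n ≤ 1 / ((n₀ + 1) * (k * 2 ^ n₀)) * (n₀ + 1) := by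
          gcongr
          · exact min_le_right _ _
          · linarith
        linarith
      have hM1 : M ≤ k * 2 ^ n₀ := by
        refine hcan'.trans ?_
        gcongr
        · norm_num
        · have : 1 * q ≤ k * q := Nat.mul_le_mul_right _ hk
          omega
      calc A * M ≤ 1 / ((n₀ + 1) * (k * 2 ^ n₀)) * (n₀ + 1) * (k * 2 ^ n₀) := by gcongr
        _ = 1 := by field_simp
  · set e : ℝ := (2 : ℝ) ^ (-(ξ * (n : ℝ))) with he
    set s : ℝ := (2 : ℝ) ^ (-(ξ / 2 * (n : ℝ))) with hs
    have hs0 : 0 < s := by positivity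
    have hes : e = s * s := by
      rw [he, hs, ← Real.rpow_add (by norm_num)]
      congr 1; ring
    have hs1 : s ≤ 1 := Real.rpow_le_one_of_one_le_of_nonpos (by norm_num)
      (neg_nonpos.2 (by positivity))
    have hsξ : s ≤ (2 : ℝ) ^ (-(ξ' * (n : ℝ))) := by
      refine Real.rpow_le_rpow_of_exponent_le (by norm_num) (neg_le_neg ?_)
      gcongr
      exact min_le_left _ _
    have hsn : (C * K + 3 * K / θ₀) * s ≤ 1 := by
      have h1 : C * K + 3 * K / θ₀ ≤ ((2 : ℝ) ^ (ξ / 2)) ^ n :=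
        hn₀.le.trans (pow_le_pow_right₀
          (Real.one_le_rpow (by norm_num) (by positivity)) hge)
      have h2 : ((2 : ℝ) ^ (ξ / 2)) ^ n * s = 1 := by
        rw [hs, ← Real.rpow_natCast, ← Real.rpow_mul (by norm_num), ← Real.rpow_add (by norm_num),
          add_neg_cancel, Real.rpow_zero]
      rw [← h2]
      gcongr
    have hθ1 : ε ≤ θ₀ / 3 := by
      have : 3 / θ₀ * ε ≤ 1 := (mul_le_mul_of_nonneg_right hC'θ hε).trans hε1.le
      rw [div_mul_eq_mul_div, div_le_one hθ₀] at this
      linarith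
    have hθ2 : η ≤ θ₀ / 3 := by
      have : 3 / θ₀ * η ≤ 1 := (mul_le_mul_of_nonneg_right hC'θ hη).trans hη1.le
      rw [div_mul_eq_mul_div, div_le_one hθ₀] at this
      linarith
    have hKs : 0 ≤ C * K * s := by positivity
    have hKs' : 0 ≤ 3 * K / θ₀ * s := by positivity
    have hKe : K * e ≤ K * s := by
      rw [hes]
      gcongr
      exact mul_le_of_le_one_left hs0.le hs1
    have hθ3 : K * e ≤ θ₀ / 3 := by
      have : 3 * K / θ₀ * s ≤ 1 := by linarith
      rw [div_mul_eq_mul_div, div_le_one hθ₀] at this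
      linarith
    have hCe : C * (K * e) ≤ s := by
      have : C * K * s ≤ 1 := by linarith
      calc C * (K * e) = C * K * s * s := by rw [hes]; ring
        _ ≤ 1 * s := by gcongr
        _ = s := one_mul s
    obtain ⟨S, hS, hSc⟩ := hmain X q hq G F ε η hε hη (by linarith)
      (hG.trans (by gcongr)) hgen hF
    refine ⟨S, hS, le_trans ?_ hSc⟩
    have hAle : A ≤ 1 - C * (ε + η + K * e) := by
      have h1 : C * ε ≤ C' * ε ^ (1 / (k : ℝ)) := by gcongr
      have h2 : C * η ≤ C' * η ^ (1 / (k : ℝ)) := by gcongr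
      linarith
    gcongr
    exact hA0.le.trans hAle
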